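/- **The graphs.** For integers $n,r,s,t\ge 1$ put $[m]=\{1,\dots,m\}$ and $\epsilon=1/(rs)$. Let $G_{n,r,s,t}$ be the weighted directed acyclic multigraph with vertices $\mathsf t$ (the target), $u_i,w_i$ ($i\in[n]$), $a_{i,j,k}$ ($i\in[n],j\in[r],k\in[s]$), $b_{i,j}$ ($i\in[n],j\in[rs]$), where $u_{n+1}=w_{n+1}=\mathsf t$, $a_{i,j,s+1}=b_{i,1}$ and $b_{i,rs+1}=w_{i+1}$, and with the following edges, for all admissible $i,j,k$. - One-edges (all of cost $0$): one edge $a_{i,j,k}\to a_{i,j,k+1}$; one edge $b_{i,j}\to b_{i,j+1}$; $t$ parallel edges $u_i\to b_{i,1}$; $t$ parallel edges $w_i\to a_{i,j,1}$ for each $j\in[r]$. - Zero-edges ($t$ parallel copies of each): $a_{i,j,k}\to u_{i+1}$ of cost $2^{2i+1}+(k-1)\epsilon$; $b_{i,j}\to u_{i+1}$ of cost $2^{2i+1}+1+(j-1)\epsilon$; $u_i\to u_{i+1}$ of cost $2^{2i}$; $w_i\to w_{i+1}$ of cost $2^{2i}$. **The algorithm.** A tree $B$ consists of one outgoing edge from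 every vertex other than $\mathsf t$; $y_B(v)$ is the length of the path from $v$ to $\mathsf t$ in $B$. An edge $e=(u,v)$ of cost $c(e)$ is an improving switch with respect to $B$ if $c(e)+y_B(v)<y_B(u)$; performing it replaces the edge of $B$ leaving $u$ by $e$. Given a bijection $\sigma$ from the edges to $\{1,\dots,M\}$, where $M$ is the number of edges, Bland's rule repeatedly performs the improving switch $e$ with the largest index $\sigma(e)$, until there is no improving switch. Random-Bland is Bland's rule with a uniformly random $\sigma$. **Theorem.** There is a constant $c>0$ such that the following holds. Let $k:\mathbb N\to\mathbb N$ satisfy $k(n)=\Theta(\log n)$ and $k(n)\ge 3\log n$ (natural logarithm) for all sufficiently large $n$; for example, $k(n)=3\lceil\log n\rceil$. Put $r=s=t=k(n)$, and let $M=M(n)$ be the number of edges of $G_{n,r,s,t}$. Then for all sufficiently large $n$, and for every initial tree $B_0$ composed entirely of zero-edges, the expected number of improving switches performed by Random-Bland on $G_{n,r,s,t}$ started from $B_0$ is at least $e^{c\sqrt n}$. Moreover $\sqrt n=\Theta\bigl(\sqrt M/\log^{3/2}M\bigr)$, and hence there is a constant $d>0$ (which may depend on the function $k$) such that, for all sufficiently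 large $n$ and every such $B_0$, this expected number is at least $e^{d\sqrt M/\log^{3/2}M}$. -/

import Mathlib

open Filter Asymptotics

/-! ## Shortest paths to a target, trees, and improving switches -/

/-- A finite weighted directed multigraph with a target vertex.  The vertices are the elements of
`Option N`, where `none` is the target; edges only leave the non-target vertices. -/
structure TargetGraph (N E : Type) where
  src : E → N
  tgt : E → Option N
  cost : E → ℝ

namespace TargetGraph

variable {N E : Type} (G : TargetGraph N E)

/-- A tree consists of one outgoing edge from every non-target vertex.  (In an acyclic graph, every
such choice of edges is a tree directed towards the target.) -/
def Tree : Type := {B : N → E // ∀ v, G.src (B v) = v}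

variable {G}

/-- The total cost of the first `m` edges of the path that starts at a vertex and follows the edges
of `B`; the path stops when it reaches the target. -/
noncomputable def pathCost (B : G.Tree) : ℕ → Option N → ℝ
  | 0, _ => 0
  | _ + 1, none => 0
  | m + 1, some v => G.cost (B.1 v) + pathCost B m (G.tgt (B.1 v))

/-- `y_B(v)`: the length of the path from `v` to the target in the tree `B`.  In an acyclic graph,
the path has reached the target after at most `|N|` edges. -/
noncomputable def value [Fintype N] (B : G.Tree) (v : Option N) : ℝ :=
  pathCost B (Fintype.card N) v

/-- The edge `e = (u, v)` is an improving switch with respect to `B`: `c(e) + y_B(v) < y_B(u)`. -/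
def IsImproving [Fintype N] (B : G.Tree) (e : E) : Prop :=
  G.cost e + value B (G.tgt e) < value B (some (G.src e))

/-- `B[e]`: the edge of `B` that leaves the source of `e` is replaced by `e`. -/
def switch [DecidableEq N] (B : G.Tree) (e : E) : G.Tree :=
  ⟨Function.update B.1 (G.src e) e, by
    intro v
    by_cases h : v = G.src e
    · subst h; simp
    · simpa [Function.update_of_ne h] using B.2 v⟩

open Classical in
/-- The set of all improving switches with respect to `B`. -/
noncomputable def improving [Fintype N] [Fintype E] (B : G.Tree) : Finset E :=
  Finset.univ.filter fun e => IsImproving B e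

/-- One step of Bland's rule for the permutation function `σ`: perform the improving switch with
the largest index, if there is an improving switch, and do nothing otherwise. -/
noncomputable def blandStep [Fintype N] [DecidableEq N] [Fintype E]
    (σ : E ≃ Fin (Fintype.card E)) (B : G.Tree) : G.Tree :=
  if h : (improving B).Nonempty then
    switch B (σ.symm (((improving B).map σ.toEmbedding).max' (h.map)))
  else B

/-- The number of improving switches that Bland's rule performs for the permutation function `σ`
when it is started from the tree `B`: the index of the first tree, in the sequence of trees
produced by the rule, that admits no improving switch. -/
noncomputable def blandSwitches [Fintype N] [DecidableEq N] [Fintype E]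
    (σ : E ≃ Fin (Fintype.card E)) (B : G.Tree) : ℕ :=
  sInf {m : ℕ | improving ((blandStep σ)^[m] B) = ∅}

/-- The expected number of improving switches performed by Random-Bland started from `B`, i.e., by
Bland's rule for a uniformly random permutation function of the edges. -/
noncomputable def expectedBlandSwitches [Fintype N] [DecidableEq N] [Fintype E] [DecidableEq E]
    (B : G.Tree) : ℝ :=
  (∑ σ : E ≃ Fin (Fintype.card E), (blandSwitches σ B : ℝ)) /
    (Fintype.card (E ≃ Fin (Fintype.card E)) : ℝ)

end TargetGraph

/-! ## The graphs `G_{n,r,s,t}`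

All indices start from `0`: the level `i : Fin n` is the level `i + 1` in the usual numbering from
`1` to `n`, and likewise for the positions `j`, `k` and the copies `l`. -/

namespace BlandGraph

/-- The non-target vertices of `G_{n,r,s,t}`. -/
inductive Node (n r s : ℕ) : Type
  | u (i : Fin n)
  | w (i : Fin n)
  | a (i : Fin n) (j : Fin r) (k : Fin s)
  | b (i : Fin n) (j : Fin (r * s))
  deriving DecidableEq, Fintype

/-- The edges of `G_{n,r,s,t}`.  The zero-edges are `a0`, `b0`, `u0`, `w0`. -/
inductive Edge (n r s t : ℕ) : Type
  | a1 (i : Fin n) (j : Fin r) (k : Fin s)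
  | a0 (i : Fin n) (j : Fin r) (k : Fin s) (l : Fin t)
  | b1 (i : Fin n) (j : Fin (r * s))
  | b0 (i : Fin n) (j : Fin (r * s)) (l : Fin t)
  | u1 (i : Fin n) (l : Fin t)
  | u0 (i : Fin n) (l : Fin t)
  | w1 (i : Fin n) (j : Fin r) (l : Fin t)
  | w0 (i : Fin n) (l : Fin t)
  deriving DecidableEq, Fintype

variable {n r s t : ℕ}

/-- The vertex `u` of level `i`, which is the target when `i` is past the last level. -/
def uAt (n r s : ℕ) (i : ℕ) : Option (Node n r s) :=
  if h : i < n then some (.u ⟨i, h⟩) else none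

/-- The vertex `w` of level `i`, which is the target when `i` is past the last level. -/
def wAt (n r s : ℕ) (i : ℕ) : Option (Node n r s) :=
  if h : i < n then some (.w ⟨i, h⟩) else none

/-- The `j`-th vertex of the `b`-path of level `i`; the path ends in `w` of the next level. -/
def bAt (i : Fin n) (j : ℕ) : Option (Node n r s) :=
  if h : j < r * s then some (.b i ⟨j, h⟩) else wAt n r s (i + 1)

/-- The `k`-th vertex of the `j`-th `a`-path of level `i`; the path ends in the first vertex of the
`b`-path of that level. -/
def aAt (i : Fin n) (j : Fin r) (k : ℕ) : Option (Node n r s) :=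
  if h : k < s then some (.a i j ⟨k, h⟩) else bAt i 0

/-- The source of an edge. -/
def src : Edge n r s t → Node n r s
  | .a1 i j k => .a i j k
  | .a0 i j k _ => .a i j k
  | .b1 i j => .b i j
  | .b0 i j _ => .b i j
  | .u1 i _ => .u i
  | .u0 i _ => .u i
  | .w1 i _ _ => .w i
  | .w0 i _ => .w i

/-- The head of an edge. -/
def tgt : Edge n r s t → Option (Node n r s)
  | .a1 i j k => aAt i j (k + 1)
  | .a0 i _ _ _ => uAt n r s (i + 1)
  | .b1 i j => bAt i (j + 1)
  | .b0 i _ _ => uAt n r s (i + 1)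
  | .u1 i _ => bAt i 0
  | .u0 i _ => uAt n r s (i + 1)
  | .w1 i j _ => aAt i j 0
  | .w0 i _ => wAt n r s (i + 1)

/-- The cost of an edge, with `ε = 1 / (r s)`.  With levels numbered from `1`, the exponents of `2`
are `2 i + 1` for the edges that leave an `a`- or `b`-path and `2 i` for the edges `u0`, `w0`. -/
noncomputable def cost : Edge n r s t → ℝ
  | .a1 _ _ _ => 0
  | .a0 i _ k _ => 2 ^ (2 * ((i : ℕ) + 1) + 1) + (k : ℝ) * (1 / ((r : ℝ) * s))
  | .b1 _ _ => 0
  | .b0 i j _ => 2 ^ (2 * ((i : ℕ) + 1) + 1) + 1 + (j : ℝ) * (1 / ((r : ℝ) * s))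
  | .u1 _ _ => 0
  | .u0 i _ => 2 ^ (2 * ((i : ℕ) + 1))
  | .w1 _ _ _ => 0
  | .w0 i _ => 2 ^ (2 * ((i : ℕ) + 1))

/-- The graph `G_{n,r,s,t}`. -/
noncomputable def graph (n r s t : ℕ) : TargetGraph (Node n r s) (Edge n r s t) where
  src := src
  tgt := tgt
  cost := cost

/-- The zero-edges of `G_{n,r,s,t}`. -/
def IsZeroEdge : Edge n r s t → Prop
  | .a0 _ _ _ _ => True
  | .b0 _ _ _ => True
  | .u0 _ _ => True
  | .w0 _ _ => True
  | _ => False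

/-- The initial trees: the trees composed entirely of zero-edges. -/
def IsInitialTree (B : (graph n r s t).Tree) : Prop :=
  ∀ v, IsZeroEdge (B.1 v)

/-- The number `M` of edges of `G_{n,r,s,t}`. -/
def numEdges (n r s t : ℕ) : ℕ := Fintype.card (Edge n r s t)

end BlandGraph

/-! For a good bijection (`IsGood`) the run behaves like a randomized binary counter. Bit `i` is set
when the `b`-path of level `i` consists of one-edges (`Full`). Let `bMin σ i` be the smallest index
on that path.

Whenever no switch of index at least `θ` improves, `u` and `w` have equal values on every level
(`AStable.uVal_eq_wVal`), and every level that is not full offers an improving one-edge on its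
`b`-path (`AStable.exists_front`). The edge of index `bMin σ i` therefore enters last on its path.
Once the path is full, `u` of level `i` profits at once through multi-edges, whose best copies have
index at least `H`. The vertex `w` has to wait, because each of its `a`-paths contains a one-edge of
index below `H`. The resulting gap between `w` and `u` propagates to all lower levels and makes
their `b`-paths fall back to zero-edges (`MultiStable.reset`, `exists_reset`).

Hence processing the edge of index `bMin σ i` allows the work on the levels below `i` to be repeated
with the indices above `bMin σ i`. This is the recursion satisfied by the number of sets of levels
on which `bMin σ` is strictly decreasing (`card_decreasingSubsets_le`), so that number bounds the
run from below (`card_decreasingSubsets_le_of_stable`).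

Goodness is invariant under permuting levels, so a fixed set of `q` levels is decreasing with
conditional probability at least `1 / q!` (`card_good_le`). A union bound makes at least half of all
bijections good. The expectation is thus at least `(n choose q) / (2 q!) - 1`, which is exponential
in `√n` for `q ≈ √n / 4`. -/

namespace TargetGraph

/-! ### Values of trees, termination, and thresholds in Bland's rule. -/

section General

variable {N E : Type} {G : TargetGraph N E}

/-- A function to the natural numbers that decreases along all edges. -/
def IsRank (G : TargetGraph N E) (ρ : Option N → ℕ) : Prop :=
  ∀ e, ρ (G.tgt e) < ρ (some (G.src e))

@[simp] lemma pathCost_none (B : G.Tree) (m : ℕ) : pathCost B m none = 0 := by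
  cases m <;> rfl

lemma switch_apply_src [DecidableEq N] (B : G.Tree) (e : E) : (switch B e).1 (G.src e) = e := by
  simp [switch]

lemma switch_apply_ne [DecidableEq N] (B : G.Tree) (e : E) {v : N} (h : v ≠ G.src e) :
    (switch B e).1 v = B.1 v := by
  simp [switch, Function.update_of_ne h]

lemma switch_apply_eq_or [DecidableEq N] (B : G.Tree) (e : E) (v : N) :
    (switch B e).1 v = B.1 v ∨ (v = G.src e ∧ (switch B e).1 v = e) := by
  by_cases h : v = G.src e
  · exact Or.inr ⟨h, h ▸ switch_apply_src B e⟩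
  · exact Or.inl (switch_apply_ne B e h)

lemma pathCost_eq_of_isRank {ρ : Option N → ℕ} (hρ : G.IsRank ρ) (B : G.Tree) (m : ℕ) :
    ∀ v, ρ v ≤ m → ∀ m', m ≤ m' → pathCost B m' v = pathCost B m v := by
  induction m with
  | zero =>
    rintro (_ | v) hv m' _
    · simp
    · have := hρ (B.1 v)
      rw [B.2 v] at this
      change ρ (some v) ≤ 0 at hv
      omega
  | succ m ih =>
    rintro (_ | v) hv m' hm'
    · simp
    · obtain ⟨m', rfl⟩ : ∃ q, m' = q + 1 := ⟨m' - 1, by omega⟩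
      have h := hρ (B.1 v)
      rw [B.2 v] at h
      change ρ (some v) ≤ _ at hv
      simp only [pathCost]
      rw [ih _ (by omega) m' (by omega)]

variable [Fintype N]

@[simp] lemma value_none (B : G.Tree) : value B none = 0 := pathCost_none _ _

/-- Counting the vertices of at most the given rank yields a rank bounded by `|N|`. This is why the
`|N|` steps in `value` always reach the target. -/
lemma exists_isRank_le_card {ρ : Option N → ℕ} (hρ : G.IsRank ρ) :
    ∃ ρ' : Option N → ℕ, G.IsRank ρ' ∧ ∀ v, ρ' v ≤ Fintype.card N := by
  classical
  refine ⟨fun v => (Finset.univ.filter fun x : N => ρ (some x) ≤ ρ v).card, fun e => ?_,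
    fun v => Finset.card_le_univ _⟩
  refine Finset.card_lt_card ⟨fun x hx => ?_, fun h => ?_⟩
  · simp only [Finset.mem_filter, Finset.mem_univ, true_and] at hx ⊢
    exact hx.trans (hρ e).le
  · have := h (x := G.src e) (by simp)
    simp only [Finset.mem_filter, Finset.mem_univ, true_and] at this
    exact absurd (hρ e) (not_lt.2 this)

lemma value_some {ρ : Option N → ℕ} (hρ : G.IsRank ρ) (B : G.Tree) (v : N) :
    value B (some v) = G.cost (B.1 v) + value B (G.tgt (B.1 v)) := by
  obtain ⟨ρ', hρ', hle⟩ := exists_isRank_le_card hρ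
  have h := hρ' (B.1 v)
  rw [B.2 v] at h
  have hv := hle (some v)
  have := pathCost_eq_of_isRank hρ' B (Fintype.card N) (some v) hv (Fintype.card N + 1) (by omega)
  unfold value
  rw [← this]
  rfl

lemma value_congr_of_closed {ρ : Option N → ℕ} (hρ : G.IsRank ρ) (B B' : G.Tree) (P : N → Prop)
    (hP : ∀ e v, P (G.src e) → G.tgt e = some v → P v) (h : ∀ v, P v → B.1 v = B'.1 v) :
    ∀ v, P v → value B (some v) = value B' (some v) := by
  intro v
  induction hm : ρ (some v) using Nat.strong_induction_on generalizing v with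
  | _ m ih =>
    intro hv
    rw [value_some hρ, value_some hρ, ← h v hv]
    have hr := hρ (B.1 v)
    rw [B.2 v] at hr
    rcases hx : G.tgt (B.1 v) with _ | x
    · simp
    · rw [hx] at hr
      rw [ih _ (hm ▸ hr) x rfl (hP (B.1 v) x (by rwa [B.2 v]) hx)]

lemma value_switch [DecidableEq N] {ρ : Option N → ℕ} (hρ : G.IsRank ρ) (B : G.Tree) {e : E}
    (he : IsImproving B e) (v : N) :
    value (switch B e) (some v) ≤ value B (some v) ∧
      (v = G.src e → value (switch B e) (some v) < value B (some v)) := by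
  induction hm : ρ (some v) using Nat.strong_induction_on generalizing v with
  | _ m ih =>
    have key : ∀ f, G.src f = v →
        value (switch B e) (G.tgt f) ≤ value B (G.tgt f) := by
      intro f hf
      have hr := hρ f
      rw [hf] at hr
      rcases hx : G.tgt f with _ | x
      · simp
      · rw [hx] at hr
        exact (ih _ (hm ▸ hr) x rfl).1
    by_cases hv : v = G.src e
    · subst hv
      have : value (switch B e) (some (G.src e)) < value B (some (G.src e)) := by
        rw [value_some hρ, switch_apply_src]
        have := key e rfl
        unfold IsImproving at he
        linarith
      exact ⟨this.le, fun _ => this⟩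
    · refine ⟨?_, fun h => absurd h hv⟩
      rw [value_some hρ, value_some hρ B, switch_apply_ne B e hv]
      have := key _ (B.2 v)
      linarith

variable [Fintype E] {σ : E ≃ Fin (Fintype.card E)}

lemma mem_improving {B : G.Tree} {e : E} : e ∈ improving B ↔ IsImproving B e := by
  classical
  simp [improving]

/-- No improving switch has index at least `m`. -/
def Stable (σ : E ≃ Fin (Fintype.card E)) (m : ℕ) (B : G.Tree) : Prop :=
  ∀ e, m ≤ (σ e : ℕ) → ¬ IsImproving B e

lemma Stable.mono {m m' : ℕ} {B : G.Tree} (h : Stable σ m B) (hm : m ≤ m') : Stable σ m' B :=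
  fun e he => h e (hm.trans he)

lemma stable_zero_iff {B : G.Tree} : Stable σ 0 B ↔ improving B = ∅ := by
  simp [Stable, Finset.eq_empty_iff_forall_notMem, mem_improving]

variable [DecidableEq N]

lemma blandStep_eq (σ : E ≃ Fin (Fintype.card E)) (B : G.Tree) (h : (improving B).Nonempty) :
    ∃ e, IsImproving B e ∧ (∀ f, IsImproving B f → σ f ≤ σ e) ∧ blandStep σ B = switch B e := by
  have hs := Finset.max'_mem ((improving B).map σ.toEmbedding) h.map
  obtain ⟨e, he, hme⟩ := Finset.mem_map.1 hs
  refine ⟨e, mem_improving.1 he, fun f hf => ?_, ?_⟩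
  · have := Finset.le_max' ((improving B).map σ.toEmbedding) (σ f)
      (Finset.mem_map.2 ⟨f, mem_improving.2 hf, rfl⟩)
    rw [← hme] at this
    exact this
  · unfold blandStep
    rw [dif_pos h, ← hme]
    simp

/-- The sum of all values strictly drops with each switch, and there are finitely many trees.
Without this, the infimum in `blandSwitches` could be that of the empty set, which is `0`. -/
lemma exists_improving_eq_empty {ρ : Option N → ℕ} (hρ : G.IsRank ρ)
    (σ : E ≃ Fin (Fintype.card E)) (B : G.Tree) :
    ∃ m, improving ((blandStep σ)^[m] B) = ∅ := by
  classical
  have : Finite G.Tree := by unfold Tree; infer_instance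
  let Φ : G.Tree → ℝ := fun B => ∑ v, value B (some v)
  have wf : WellFounded (InvImage (· < ·) Φ) := by
    have : IsTrans G.Tree (InvImage (· < ·) Φ) := ⟨fun a b c h h' => lt_trans (α := ℝ) h h'⟩
    have : Std.Irrefl (InvImage (· < ·) Φ) := ⟨fun a h => lt_irrefl (Φ a) h⟩
    exact Finite.wellFounded_of_trans_of_irrefl _
  induction B using wf.induction with
  | _ B ih =>
    by_cases h : (improving B).Nonempty
    · obtain ⟨e, he, -, hs⟩ := blandStep_eq σ B h
      have hlt : Φ (blandStep σ B) < Φ B := by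
        rw [hs]
        exact Finset.sum_lt_sum (fun v _ => (value_switch hρ B he v).1)
          ⟨G.src e, Finset.mem_univ _, (value_switch hρ B he _).2 rfl⟩
      obtain ⟨m, hm⟩ := ih _ hlt
      exact ⟨m + 1, by rwa [Function.iterate_succ_apply]⟩
    · exact ⟨0, by simpa [Finset.not_nonempty_iff_eq_empty] using h⟩

lemma stable_blandSwitches {ρ : Option N → ℕ} (hρ : G.IsRank ρ)
    (σ : E ≃ Fin (Fintype.card E)) (B : G.Tree) :
    Stable σ 0 ((blandStep σ)^[blandSwitches σ B] B) :=
  stable_zero_iff.2 (Nat.sInf_mem (exists_improving_eq_empty hρ σ B))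

/-- This splits a run into phases: until threshold `m` is stable, every switch performed has index
at least `m`. -/
lemma blandStep_of_not_stable {m : ℕ} {B : G.Tree} (h : ¬ Stable σ m B) :
    ∃ e, IsImproving B e ∧ m ≤ (σ e : ℕ) ∧ (∀ f, IsImproving B f → σ f ≤ σ e) ∧
      blandStep σ B = switch B e := by
  unfold Stable at h
  push Not at h
  obtain ⟨f, hf, hfi⟩ := h
  obtain ⟨e, he, hmax, hs⟩ := blandStep_eq σ B ⟨f, mem_improving.2 hfi⟩
  exact ⟨e, he, hf.trans (hmax f hfi), hmax, hs⟩

/-- Along a run of Bland's rule, an invariant is kept until the first time at which a property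
holds, provided that steps from trees without the property preserve the invariant. -/
lemma exists_first_time {α : Type*} (step : α → α) (P I : α → Prop) (x : α) (hI : I x)
    (hstep : ∀ y, I y → ¬ P y → I (step y)) (l : ℕ) (hl : P (step^[l] x)) :
    ∃ q ≤ l, I (step^[q] x) ∧ P (step^[q] x) := by
  induction l generalizing x with
  | zero => exact ⟨0, le_rfl, hI, hl⟩
  | succ l ih =>
    by_cases hx : P x
    · exact ⟨0, by omega, hI, hx⟩
    · obtain ⟨q, hq, h1, h2⟩ := ih (step x) (hstep x hI hx) (by simpa using hl)
      exact ⟨q + 1, by omega, by simpa using h1, by simpa using h2⟩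

end General

end TargetGraph

/-! ### Acyclicity of the graphs, and values and improving switches in coordinates. -/

namespace BlandGraph

open TargetGraph

variable {n r s t : ℕ}

/-- The level of a vertex. -/
def level : Node n r s → ℕ
  | .u i => i
  | .w i => i
  | .a i _ _ => i
  | .b i _ => i

/-- The position of a vertex within its level; it decreases along the edges inside the level. -/
def offset : Node n r s → ℕ
  | .u _ => r * s + s + 1
  | .w _ => r * s + s + 1
  | .a _ _ k => r * s + (s - k)
  | .b _ j => r * s - j

/-- A rank of the vertices that decreases along all edges. -/
def rank : Option (Node n r s) → ℕ
  | none => 0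
  | some v => (n - 1 - level v) * (r * s + s + 2) + offset v

lemma level_lt (v : Node n r s) : level v < n := by
  cases v <;> simp [level]

lemma offset_pos (v : Node n r s) : 0 < offset v := by
  cases v with
  | u i => simp [offset]
  | w i => simp [offset]
  | a i j k => have := k.2; simp only [offset]; omega
  | b i j => have := j.2; simp only [offset]; omega

lemma offset_lt (v : Node n r s) : offset v < r * s + s + 2 := by
  cases v <;> simp only [offset] <;> omega

lemma rank_lt_of_level_lt {v v' : Node n r s} (h : level v < level v') :
    rank (some v') < rank (some v) := by
  have h1 := offset_lt v'
  have h2 := level_lt v'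
  simp only [rank]
  obtain ⟨d, hd⟩ : ∃ d, n - 1 - level v = (n - 1 - level v') + 1 + d :=
    ⟨n - 1 - level v - (n - 1 - level v') - 1, by omega⟩
  rw [hd, add_mul, add_mul]
  omega

lemma rank_lt_of_offset_lt {v v' : Node n r s} (h : level v = level v')
    (h' : offset v' < offset v) : rank (some v') < rank (some v) := by
  simp only [rank, h]; omega

lemma rank_none_lt (v : Node n r s) : rank (none : Option (Node n r s)) < rank (some v) := by
  have := offset_pos v
  simp only [rank]; omega

lemma rank_uAt_lt (v : Node n r s) : rank (uAt n r s (level v + 1)) < rank (some v) := by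
  unfold uAt
  split_ifs
  · exact rank_lt_of_level_lt (by simp [level])
  · exact rank_none_lt v

lemma rank_wAt_lt (v : Node n r s) : rank (wAt n r s (level v + 1)) < rank (some v) := by
  unfold wAt
  split_ifs
  · exact rank_lt_of_level_lt (by simp [level])
  · exact rank_none_lt v

lemma rank_bAt_lt (v : Node n r s) (i : Fin n) (hi : level v = i) (j : ℕ)
    (hj : r * s - j < offset v) : rank (bAt (r := r) (s := s) i j) < rank (some v) := by
  unfold bAt
  split_ifs
  · exact rank_lt_of_offset_lt hi hj
  · rw [← hi]; exact rank_wAt_lt v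

lemma rank_aAt_lt (v : Node n r s) (i : Fin n) (hi : level v = i) (j : Fin r) (k : ℕ)
    (hk : r * s + (s - k) < offset v) : rank (aAt (r := r) (s := s) i j k) < rank (some v) := by
  unfold aAt
  split_ifs
  · exact rank_lt_of_offset_lt hi hk
  · exact rank_bAt_lt v i hi 0 (by omega)

lemma isRank_rank : (graph n r s t).IsRank rank := by
  intro e
  cases e with
  | a1 i j k =>
    have := k.2
    exact rank_aAt_lt (.a i j k) i rfl j _ (by simp only [offset]; omega)
  | a0 i j k l => exact rank_uAt_lt (.a i j k)
  | b1 i j =>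
    have := j.2
    exact rank_bAt_lt (.b i j) i rfl _ (by simp only [offset]; omega)
  | b0 i j l => exact rank_uAt_lt (.b i j)
  | u1 i l => exact rank_bAt_lt (.u i) i rfl 0 (by simp only [offset]; omega)
  | u0 i l => exact rank_uAt_lt (.u i)
  | w1 i j l => exact rank_aAt_lt (.w i) i rfl j 0 (by simp only [offset]; omega)
  | w0 i l => exact rank_wAt_lt (.w i)

section Values

variable (B : (graph n r s t).Tree)

/-- The value of `u` at a level. -/
noncomputable def uVal (i : ℕ) : ℝ := value B (uAt n r s i)

/-- The value of `w` at a level. -/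
noncomputable def wVal (i : ℕ) : ℝ := value B (wAt n r s i)

/-- The values on the `b`-path. -/
noncomputable def bVal (i : Fin n) (j : ℕ) : ℝ := value B (bAt (r := r) (s := s) i j)

/-- The values on an `a`-path. -/
noncomputable def aVal (i : Fin n) (j : Fin r) (k : ℕ) : ℝ :=
  value B (aAt (r := r) (s := s) i j k)

/-- The increment `ε` of the costs along the paths. -/
noncomputable def eps (r s : ℕ) : ℝ := 1 / ((r : ℝ) * s)

lemma eps_pos {j : ℕ} (h : j < r * s) : 0 < eps r s := by
  have h : 0 < r * s := by omega
  have : (0 : ℝ) < (r : ℝ) * s := by exact_mod_cast h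
  unfold eps; positivity

lemma mul_eps_lt_one {j : ℕ} (h : j < r * s) : (j : ℝ) * eps r s < 1 := by
  have h' : (j : ℝ) < (r : ℝ) * s := by exact_mod_cast h
  have : (0 : ℝ) < (r : ℝ) * s := lt_of_le_of_lt (Nat.cast_nonneg j) h'
  unfold eps
  rw [mul_one_div, div_lt_one this]
  exact h'

lemma mul_eps_le_one {k : ℕ} (j : Fin r) (h : k ≤ s) : (k : ℝ) * eps r s ≤ 1 := by
  have hr : 1 ≤ r := by have := j.2; omega
  have h1 : k ≤ r * s := h.trans (Nat.le_mul_of_pos_left s hr)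
  rcases Nat.eq_zero_or_pos (r * s) with h0 | h0
  · have : k = 0 := by omega
    simp [this]
  · have h' : (k : ℝ) ≤ (r : ℝ) * s := by exact_mod_cast h1
    have : (0 : ℝ) < (r : ℝ) * s := by exact_mod_cast h0
    unfold eps
    rw [mul_one_div, div_le_one this]
    exact h'

lemma uVal_fin (i : Fin n) : uVal B i = value B (some (.u i)) := by simp [uVal, uAt]

lemma wVal_fin (i : Fin n) : wVal B i = value B (some (.w i)) := by simp [wVal, wAt]

lemma bVal_fin (i : Fin n) (j : Fin (r * s)) : bVal B i j = value B (some (.b i j)) := by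
  simp [bVal, bAt]

lemma aVal_fin (i : Fin n) (j : Fin r) (k : Fin s) :
    aVal B i j k = value B (some (.a i j k)) := by simp [aVal, aAt]

lemma uVal_of_ge {i : ℕ} (h : n ≤ i) : uVal B i = 0 := by simp [uVal, uAt, not_lt.2 h]

lemma wVal_of_ge {i : ℕ} (h : n ≤ i) : wVal B i = 0 := by simp [wVal, wAt, not_lt.2 h]

lemma bVal_end (i : Fin n) : bVal B i (r * s) = wVal B (i + 1) := by
  simp [bVal, bAt, wVal]

lemma aVal_end (i : Fin n) (j : Fin r) : aVal B i j s = bVal B i 0 := by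
  simp [aVal, aAt, bVal]

lemma improving_a1 (i : Fin n) (j : Fin r) (k : Fin s) :
    IsImproving B (.a1 i j k : Edge n r s t) ↔ aVal B i j (k + 1) < aVal B i j k := by
  rw [aVal_fin]
  change 0 + aVal B i j (k + 1) < _ ↔ _
  rw [zero_add]; rfl

lemma improving_b1 (i : Fin n) (j : Fin (r * s)) :
    IsImproving B (.b1 i j : Edge n r s t) ↔ bVal B i (j + 1) < bVal B i j := by
  rw [bVal_fin]
  change 0 + bVal B i (j + 1) < _ ↔ _
  rw [zero_add]; rfl

lemma improving_a0 (i : Fin n) (j : Fin r) (k : Fin s) (l : Fin t) :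
    IsImproving B (.a0 i j k l : Edge n r s t) ↔
      2 * 4 ^ ((i : ℕ) + 1) + (k : ℕ) * eps r s + uVal B (i + 1) < aVal B i j k := by
  rw [aVal_fin]
  change 2 ^ (2 * ((i : ℕ) + 1) + 1) + ((k : ℕ) : ℝ) * eps r s + uVal B (i + 1) < _ ↔ _
  rw [pow_succ, pow_mul, mul_comm]; norm_num; rfl

lemma improving_b0 (i : Fin n) (j : Fin (r * s)) (l : Fin t) :
    IsImproving B (.b0 i j l : Edge n r s t) ↔
      2 * 4 ^ ((i : ℕ) + 1) + 1 + (j : ℕ) * eps r s + uVal B (i + 1) < bVal B i j := by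
  rw [bVal_fin]
  change 2 ^ (2 * ((i : ℕ) + 1) + 1) + 1 + ((j : ℕ) : ℝ) * eps r s + uVal B (i + 1) < _ ↔ _
  rw [pow_succ, pow_mul, mul_comm]; norm_num; rfl

lemma improving_u1 (i : Fin n) (l : Fin t) :
    IsImproving B (.u1 i l : Edge n r s t) ↔ bVal B i 0 < uVal B i := by
  rw [uVal_fin]
  change 0 + bVal B i 0 < _ ↔ _
  rw [zero_add]; rfl

lemma improving_u0 (i : Fin n) (l : Fin t) :
    IsImproving B (.u0 i l : Edge n r s t) ↔ 4 ^ ((i : ℕ) + 1) + uVal B (i + 1) < uVal B i := by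
  rw [uVal_fin]
  change 2 ^ (2 * ((i : ℕ) + 1)) + uVal B (i + 1) < _ ↔ _
  rw [pow_mul]; norm_num; rfl

lemma improving_w1 (i : Fin n) (j : Fin r) (l : Fin t) :
    IsImproving B (.w1 i j l : Edge n r s t) ↔ aVal B i j 0 < wVal B i := by
  rw [wVal_fin]
  change 0 + aVal B i j 0 < _ ↔ _
  rw [zero_add]; rfl

lemma improving_w0 (i : Fin n) (l : Fin t) :
    IsImproving B (.w0 i l : Edge n r s t) ↔ 4 ^ ((i : ℕ) + 1) + wVal B (i + 1) < wVal B i := by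
  rw [wVal_fin]
  change 2 ^ (2 * ((i : ℕ) + 1)) + wVal B (i + 1) < _ ↔ _
  rw [pow_mul]; norm_num; rfl

/-- The one-edge of a vertex of the `b`-path belongs to the tree. -/
def BOne (i : Fin n) (j : Fin (r * s)) : Prop := B.1 (.b i j) = .b1 i j

/-- The one-edge of a vertex of an `a`-path belongs to the tree. -/
def AOne (i : Fin n) (j : Fin r) (k : Fin s) : Prop := B.1 (.a i j k) = .a1 i j k

variable {B}

lemma BOne.bVal_eq {i : Fin n} {j : Fin (r * s)} (h : BOne B i j) :
    bVal B i j = bVal B i (j + 1) := by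
  rw [bVal_fin, value_some isRank_rank, h]
  exact zero_add _

lemma AOne.aVal_eq {i : Fin n} {j : Fin r} {k : Fin s} (h : AOne B i j k) :
    aVal B i j k = aVal B i j (k + 1) := by
  rw [aVal_fin, value_some isRank_rank, h]
  exact zero_add _

lemma bVal_of_not_bOne {i : Fin n} {j : Fin (r * s)} (h : ¬ BOne B i j) :
    bVal B i j = 2 * 4 ^ ((i : ℕ) + 1) + 1 + (j : ℕ) * eps r s + uVal B (i + 1) := by
  have hs := B.2 (.b i j)
  unfold BOne at h
  rw [bVal_fin, value_some isRank_rank]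
  rcases hB : B.1 (.b i j) with _ | _ | _ | ⟨i', j', l⟩ | _ | _ | _ | _ <;>
    rw [hB] at hs h <;> simp [graph, src] at hs
  · obtain ⟨rfl, rfl⟩ := hs
    exact absurd rfl h
  · obtain ⟨rfl, rfl⟩ := hs
    change 2 ^ (2 * ((i' : ℕ) + 1) + 1) + 1 + ((j' : ℕ) : ℝ) * eps r s + uVal B (i' + 1) = _
    rw [pow_succ, pow_mul, mul_comm]; norm_num

lemma aVal_of_not_aOne {i : Fin n} {j : Fin r} {k : Fin s} (h : ¬ AOne B i j k) :
    aVal B i j k = 2 * 4 ^ ((i : ℕ) + 1) + (k : ℕ) * eps r s + uVal B (i + 1) := by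
  have hs := B.2 (.a i j k)
  unfold AOne at h
  rw [aVal_fin, value_some isRank_rank]
  rcases hB : B.1 (.a i j k) with _ | ⟨i', j', k', l⟩ | _ | _ | _ | _ | _ | _ <;>
    rw [hB] at hs h <;> simp [graph, src] at hs
  · obtain ⟨rfl, rfl, rfl⟩ := hs
    exact absurd rfl h
  · obtain ⟨rfl, rfl, rfl⟩ := hs
    change 2 ^ (2 * ((i' : ℕ) + 1) + 1) + ((k' : ℕ) : ℝ) * eps r s + uVal B (i' + 1) = _
    rw [pow_succ, pow_mul, mul_comm]; norm_num

variable (B)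

lemma uVal_eq_or (i : Fin n) :
    uVal B i = 4 ^ ((i : ℕ) + 1) + uVal B (i + 1) ∨ uVal B i = bVal B i 0 := by
  have hs := B.2 (.u i)
  rw [uVal_fin, value_some isRank_rank]
  rcases hB : B.1 (.u i) with _ | _ | _ | _ | ⟨i', l⟩ | ⟨i', l⟩ | _ | _ <;>
    rw [hB] at hs <;> simp [graph, src] at hs
  · subst hs
    right
    exact zero_add _
  · subst hs
    left
    change 2 ^ (2 * ((i' : ℕ) + 1)) + uVal B (i' + 1) = _
    rw [pow_mul]; norm_num

lemma wVal_eq_or (i : Fin n) :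
    wVal B i = 4 ^ ((i : ℕ) + 1) + wVal B (i + 1) ∨ ∃ j, wVal B i = aVal B i j 0 := by
  have hs := B.2 (.w i)
  rw [wVal_fin, value_some isRank_rank]
  rcases hB : B.1 (.w i) with _ | _ | _ | _ | _ | _ | ⟨i', j, l⟩ | ⟨i', l⟩ <;>
    rw [hB] at hs <;> simp [graph, src] at hs
  · subst hs
    right
    exact ⟨j, zero_add _⟩
  · subst hs
    left
    change 2 ^ (2 * ((i' : ℕ) + 1)) + wVal B (i' + 1) = _
    rw [pow_mul]; norm_num

end Values

end BlandGraph

namespace BlandGraph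

open TargetGraph

variable {n r s t : ℕ}

/-! ### The shape of trees in which the edges of large index have settled. -/

section Stability

variable {B : (graph n r s t).Tree}

/-- The edges that occur in `t` parallel copies. -/
def IsMulti : Edge n r s t → Prop
  | .a1 _ _ _ => False
  | .b1 _ _ => False
  | _ => True

/-- No multi-edge is an improving switch. -/
def MultiStable (B : (graph n r s t).Tree) : Prop :=
  ∀ e : Edge n r s t, IsMulti e → ¬ IsImproving B e

lemma MultiStable.aVal_le (h : MultiStable B) (ht : 0 < t) (i : Fin n) (j : Fin r) (k : Fin s) :
    aVal B i j k ≤ 2 * 4 ^ ((i : ℕ) + 1) + (k : ℕ) * eps r s + uVal B (i + 1) :=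
  not_lt.1 fun h' => h (.a0 i j k ⟨0, ht⟩) trivial ((improving_a0 B i j k _).2 h')

lemma MultiStable.bVal_le (h : MultiStable B) (ht : 0 < t) (i : Fin n) (j : Fin (r * s)) :
    bVal B i j ≤ 2 * 4 ^ ((i : ℕ) + 1) + 1 + (j : ℕ) * eps r s + uVal B (i + 1) :=
  not_lt.1 fun h' => h (.b0 i j ⟨0, ht⟩) trivial ((improving_b0 B i j _).2 h')

lemma MultiStable.uVal_le_bVal (h : MultiStable B) (ht : 0 < t) (i : Fin n) :
    uVal B i ≤ bVal B i 0 :=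
  not_lt.1 fun h' => h (.u1 i ⟨0, ht⟩) trivial ((improving_u1 B i _).2 h')

lemma MultiStable.uVal_le (h : MultiStable B) (ht : 0 < t) (i : Fin n) :
    uVal B i ≤ 4 ^ ((i : ℕ) + 1) + uVal B (i + 1) :=
  not_lt.1 fun h' => h (.u0 i ⟨0, ht⟩) trivial ((improving_u0 B i _).2 h')

lemma MultiStable.wVal_le_aVal (h : MultiStable B) (ht : 0 < t) (i : Fin n) (j : Fin r) :
    wVal B i ≤ aVal B i j 0 :=
  not_lt.1 fun h' => h (.w1 i j ⟨0, ht⟩) trivial ((improving_w1 B i j _).2 h')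

lemma MultiStable.wVal_le (h : MultiStable B) (ht : 0 < t) (i : Fin n) :
    wVal B i ≤ 4 ^ ((i : ℕ) + 1) + wVal B (i + 1) :=
  not_lt.1 fun h' => h (.w0 i ⟨0, ht⟩) trivial ((improving_w0 B i _).2 h')

/-- The path from position `j` runs along free one-edges and leaves the `b`-path by a zero-edge at
`j'` at the latest. -/
lemma bVal_ge_of_not_bOne {i : Fin n} {j : ℕ} {j' : Fin (r * s)} (hj : j ≤ j')
    (h : ¬ BOne B i j') : 2 * 4 ^ ((i : ℕ) + 1) + 1 + uVal B (i + 1) ≤ bVal B i j := by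
  obtain ⟨d, hd⟩ : ∃ d, (j' : ℕ) = j + d := ⟨j' - j, by omega⟩
  induction d generalizing j with
  | zero =>
    obtain rfl : (j' : ℕ) = j := by omega
    rw [bVal_of_not_bOne h]
    have := eps_pos j'.2
    nlinarith [Nat.cast_nonneg (α := ℝ) (j' : ℕ)]
  | succ d ih =>
    have hlt : j < r * s := by have := j'.2; omega
    by_cases h1 : BOne B i ⟨j, hlt⟩
    · have := h1.bVal_eq
      simp only at this
      rw [this]
      exact ih (by omega) (by omega)
    · have := bVal_of_not_bOne h1
      simp only at this
      rw [this]
      have := eps_pos hlt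
      nlinarith [Nat.cast_nonneg (α := ℝ) j]

lemma bVal_of_bOne {i : Fin n} {j : ℕ} (hj : j ≤ r * s)
    (h : ∀ j' : Fin (r * s), j ≤ j' → BOne B i j') : bVal B i j = wVal B (i + 1) := by
  obtain ⟨d, hd⟩ : ∃ d, r * s = j + d := ⟨r * s - j, by omega⟩
  induction d generalizing j with
  | zero =>
    obtain rfl : r * s = j := by omega
    exact bVal_end B i
  | succ d ih =>
    have hlt : j < r * s := by omega
    have := (h ⟨j, hlt⟩ le_rfl).bVal_eq
    simp only at this
    rw [this]
    exact ih (by omega) (fun j' hj' => h j' (by omega)) (by omega)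

/-- The zero-edge costs grow by `ε` along the path. A one-edge followed by a zero-edge would be
beaten by the zero-edge one position earlier, so the one-edges form a final segment. -/
lemma MultiStable.bOne_of_le (h : MultiStable B) (ht : 0 < t) {i : Fin n} {j : Fin (r * s)}
    (hj : BOne B i j) {j' : Fin (r * s)} (hjj : (j : ℕ) ≤ j') :
    BOne B i j' := by
  obtain ⟨d, hd⟩ : ∃ d, (j' : ℕ) = j + d := ⟨j' - j, by omega⟩
  induction d generalizing j with
  | zero =>
    obtain rfl : j = j' := Fin.ext (by omega)
    exact hj
  | succ d ih =>
    have hlt : (j : ℕ) + 1 < r * s := by have := j'.2; omega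
    refine ih (j := ⟨j + 1, hlt⟩) ?_ (by change (j : ℕ) + 1 ≤ j'; omega)
      (by change (j' : ℕ) = (j : ℕ) + 1 + d; omega)
    by_contra hn
    have h1 := bVal_of_not_bOne hn
    have h2 := hj.bVal_eq
    have h3 := h.bVal_le ht i j
    have := eps_pos hlt
    push_cast at h1
    linarith

/-- The one-edges of the whole `b`-path of a level belong to the tree. -/
def Full (B : (graph n r s t).Tree) (i : Fin n) : Prop := ∀ j, BOne B i j

lemma Full.bVal_eq {i : Fin n} (h : Full B i) : bVal B i 0 = wVal B (i + 1) :=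
  bVal_of_bOne (Nat.zero_le _) fun j _ => h j

lemma bVal_ge_of_not_full {i : Fin n} (h : ¬ Full B i) :
    2 * 4 ^ ((i : ℕ) + 1) + 1 + uVal B (i + 1) ≤ bVal B i 0 := by
  unfold Full at h
  push Not at h
  obtain ⟨j, hj⟩ := h
  exact bVal_ge_of_not_bOne (Nat.zero_le _) hj

lemma aVal_ge_of_not_aOne {i : Fin n} {j : Fin r} {k : ℕ} {k' : Fin s} (hk : k ≤ k')
    (h : ¬ AOne B i j k') : 2 * 4 ^ ((i : ℕ) + 1) + uVal B (i + 1) ≤ aVal B i j k := by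
  have heps : 0 ≤ eps r s := by unfold eps; positivity
  obtain ⟨d, hd⟩ : ∃ d, (k' : ℕ) = k + d := ⟨k' - k, by omega⟩
  induction d generalizing k with
  | zero =>
    obtain rfl : (k' : ℕ) = k := by omega
    rw [aVal_of_not_aOne h]
    nlinarith [Nat.cast_nonneg (α := ℝ) (k' : ℕ)]
  | succ d ih =>
    have hlt : k < s := by have := k'.2; omega
    by_cases h1 : AOne B i j ⟨k, hlt⟩
    · have := h1.aVal_eq
      simp only at this
      rw [this]
      exact ih (by omega) (by omega)
    · have := aVal_of_not_aOne h1
      simp only at this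
      rw [this]
      nlinarith [Nat.cast_nonneg (α := ℝ) k]

lemma aVal_of_aOne {i : Fin n} {j : Fin r} {k : ℕ} (hk : k ≤ s)
    (h : ∀ k' : Fin s, k ≤ k' → AOne B i j k') : aVal B i j k = bVal B i 0 := by
  obtain ⟨d, hd⟩ : ∃ d, s = k + d := ⟨s - k, by omega⟩
  induction d generalizing k with
  | zero =>
    obtain rfl : s = k := by omega
    exact aVal_end B i j
  | succ d ih =>
    have hlt : k < s := by omega
    have := (h ⟨k, hlt⟩ le_rfl).aVal_eq
    simp only at this
    rw [this]
    exact ih (by omega) (fun k' hk' => h k' (by omega)) (by omega)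

lemma aVal_zero_ge (B : (graph n r s t).Tree) (i : Fin n) (j : Fin r) :
    min (2 * 4 ^ ((i : ℕ) + 1) + uVal B (i + 1)) (bVal B i 0) ≤ aVal B i j 0 := by
  by_cases h : ∀ k, AOne B i j k
  · rw [aVal_of_aOne (Nat.zero_le _) fun k _ => h k]
    exact min_le_right _ _
  · push Not at h
    obtain ⟨k, hk⟩ := h
    exact (min_le_left _ _).trans (aVal_ge_of_not_aOne (Nat.zero_le _) hk)

lemma aVal_le_bVal {i : Fin n} {j : Fin r}
    (h : ∀ k, ¬ IsImproving B (.a1 i j k : Edge n r s t)) {k : ℕ} (hk : k ≤ s) :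
    aVal B i j k ≤ bVal B i 0 := by
  obtain ⟨d, hd⟩ : ∃ d, s = k + d := ⟨s - k, by omega⟩
  induction d generalizing k with
  | zero =>
    obtain rfl : s = k := by omega
    exact (aVal_end B i j).le
  | succ d ih =>
    have hlt : k < s := by omega
    have := h ⟨k, hlt⟩
    rw [improving_a1, not_lt] at this
    exact this.trans (ih (k := k + 1) (by omega) (by omega))

/-- All vertices of the `a`-paths of a level use zero-edges. -/
def AZero (B : (graph n r s t).Tree) (i : Fin n) : Prop := ∀ j k, ¬ AOne B i j k

/-- Postponing the exit by one position costs `ε` more. Entering a `b`-path that is not full costs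
an extra `1`, which outweighs every `k * ε`. -/
lemma AZero.not_improving_a1 {i : Fin n} (h : AZero B i) (hf : ¬ Full B i) (j : Fin r)
    (k : Fin s) : ¬ IsImproving B (.a1 i j k : Edge n r s t) := by
  rw [improving_a1, aVal_of_not_aOne (h j k), not_lt]
  have heps : 0 ≤ eps r s := by unfold eps; positivity
  by_cases hk : (k : ℕ) + 1 < s
  · have := aVal_of_not_aOne (h j ⟨k + 1, hk⟩)
    simp only at this
    rw [this]
    push_cast
    linarith
  · obtain hk : (k : ℕ) + 1 = s := by have := k.2; omega
    rw [hk, aVal_end]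
    have := bVal_ge_of_not_full hf
    have := mul_eps_le_one j k.2.le
    linarith

/-- Backward induction along the `a`-path: the value at position `k + 1` is at least the exit cost
there, so a one-edge at `k` would lose `ε` against the zero-edge at `k`. -/
lemma MultiStable.aZero (h : MultiStable B) (ht : 0 < t) {i : Fin n} (hf : ¬ Full B i) :
    AZero B i := by
  have hb := bVal_ge_of_not_full hf
  intro j
  have key : ∀ d (k : ℕ), k + d = s →
      2 * 4 ^ ((i : ℕ) + 1) + (k : ℝ) * eps r s + uVal B (i + 1) ≤ aVal B i j k ∧
      ∀ hk : k < s, ¬ AOne B i j ⟨k, hk⟩ := by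
    intro d
    induction d with
    | zero =>
      intro k hk
      obtain hk : k = s := by omega
      refine ⟨?_, fun hk => by omega⟩
      have := mul_eps_le_one j (Nat.le_refl s)
      rw [hk, aVal_end]
      linarith
    | succ d ih =>
      intro k hk
      have hlt : k < s := by omega
      have hn : ¬ AOne B i j ⟨k, hlt⟩ := by
        intro hone
        have h1 := hone.aVal_eq
        have h2 := h.aVal_le ht i j ⟨k, hlt⟩
        have h3 := (ih (k + 1) (by omega)).1
        have : 0 < eps r s := eps_pos (j := 0)
          (Nat.mul_pos (by have := j.2; omega) (by omega))
        push_cast at h3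
        simp only at h1 h2
        linarith
      refine ⟨?_, fun _ => hn⟩
      have := aVal_of_not_aOne hn
      simp only at this
      rw [this]
  intro k
  exact (key (s - k) k (by omega)).2 k.2

/-- No multi-edge is an improving switch, and on every level no one-edge of some `a`-path is. -/
def AStable (B : (graph n r s t).Tree) : Prop :=
  MultiStable B ∧ ∀ i : Fin n, ∃ j, ∀ k, ¬ IsImproving B (.a1 i j k : Edge n r s t)

/-- Induction from the target. On a full level both vertices reach `w` of the next level for free,
`w` using the `a`-path without improving one-edges. On any other level a detour costs at least `2 *
4 ^ (i + 1)`, so both skip the level at cost `4 ^ (i + 1)`. -/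
lemma AStable.uVal_eq_wVal (h : AStable B) (ht : 0 < t) (i : ℕ) : uVal B i = wVal B i := by
  obtain ⟨d, hd⟩ : ∃ d, n ≤ i + d := ⟨n, by omega⟩
  induction d generalizing i with
  | zero => rw [uVal_of_ge B (by omega), wVal_of_ge B (by omega)]
  | succ d ih =>
    rcases Nat.lt_or_ge i n with hlt | hge
    swap
    · rw [uVal_of_ge B hge, wVal_of_ge B hge]
    have ih := ih (i + 1) (by omega)
    obtain ⟨i, rfl⟩ : ∃ i' : Fin n, (i' : ℕ) = i := ⟨⟨i, hlt⟩, rfl⟩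
    have hpos : (0 : ℝ) < 4 ^ ((i : ℕ) + 1) := by positivity
    have hu0 := h.1.uVal_le ht i
    have hw0 := h.1.wVal_le ht i
    have hu1 := h.1.uVal_le_bVal ht i
    obtain ⟨j, hj⟩ := h.2 i
    have hwa := h.1.wVal_le_aVal ht i j
    have hab : aVal B i j 0 ≤ bVal B i 0 := aVal_le_bVal hj (Nat.zero_le _)
    have hge : ∀ j, min (2 * 4 ^ ((i : ℕ) + 1) + uVal B (i + 1)) (bVal B i 0) ≤ aVal B i j 0 :=
      aVal_zero_ge B i
    by_cases hf : Full B i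
    · have hb := hf.bVal_eq
      have hmin : min (2 * 4 ^ ((i : ℕ) + 1) + uVal B (i + 1)) (bVal B i 0) = bVal B i 0 :=
        min_eq_right (by linarith)
      rw [hmin] at hge
      have hu : uVal B i = bVal B i 0 := by
        rcases uVal_eq_or B i with h' | h' <;> linarith
      have hw : wVal B i = bVal B i 0 := by
        rcases wVal_eq_or B i with h' | ⟨j', h'⟩
        · linarith
        · have := hge j'; linarith
      rw [hu, hw]
    · have hb := bVal_ge_of_not_full hf
      have hmin : min (2 * 4 ^ ((i : ℕ) + 1) + uVal B (i + 1)) (bVal B i 0) =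
          2 * 4 ^ ((i : ℕ) + 1) + uVal B (i + 1) := min_eq_left (by linarith)
      rw [hmin] at hge
      have hu : uVal B i = 4 ^ ((i : ℕ) + 1) + uVal B (i + 1) := by
        rcases uVal_eq_or B i with h' | h' <;> linarith
      have hw : wVal B i = 4 ^ ((i : ℕ) + 1) + wVal B (i + 1) := by
        rcases wVal_eq_or B i with h' | ⟨j', h'⟩
        · linarith
        · have := hge j'; linarith
      rw [hu, hw, ih]

/-- Behind the last missing one-edge the path leads for free to `w` of the next level, whose value
equals that of `u`, whereas the zero-edge pays a positive cost to reach `u`. -/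
lemma AStable.exists_front (h : AStable B) (ht : 0 < t) {i : Fin n} (hf : ¬ Full B i) :
    ∃ j : Fin (r * s), ¬ BOne B i j ∧ (∀ j', j < j' → BOne B i j') ∧
      IsImproving B (.b1 i j : Edge n r s t) := by
  classical
  unfold Full at hf
  push Not at hf
  obtain ⟨j, hj, hmax⟩ := Finset.exists_max_image
    (Finset.univ.filter fun j => ¬ BOne B i j) id
    (hf.imp fun j hj => by simpa using hj)
  simp only [Finset.mem_filter, Finset.mem_univ, true_and, id] at hj hmax
  have hones : ∀ j', j < j' → BOne B i j' := fun j' hlt => by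
    by_contra hn
    exact absurd (hmax j' hn) (not_le.2 hlt)
  refine ⟨j, hj, hones, ?_⟩
  rw [improving_b1, bVal_of_not_bOne hj, bVal_of_bOne (by omega)
    (fun j' hj' => hones j' (Fin.lt_def.2 (by omega))), h.uVal_eq_wVal ht]
  have := eps_pos j.2
  have : (0 : ℝ) < 4 ^ ((i : ℕ) + 1) := by positivity
  nlinarith [Nat.cast_nonneg (α := ℝ) (j : ℕ)]

/-- The full `b`-path is free for `u`. Each `a`-path still exits at cost at least `2 * 4 ^ (i + 1)`,
so `w` has to skip the level at cost `4 ^ (i + 1)`. -/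
lemma MultiStable.wVal_sub_uVal_of_full (h : MultiStable B) (ht : 0 < t) {i : Fin n}
    (hf : Full B i) (heq : uVal B (i + 1) = wVal B (i + 1)) (ha : ∀ j, ∃ k, ¬ AOne B i j k) :
    wVal B i = uVal B i + 4 ^ ((i : ℕ) + 1) := by
  have hpos : (0 : ℝ) < 4 ^ ((i : ℕ) + 1) := by positivity
  have hb := hf.bVal_eq
  have hu0 := h.uVal_le_bVal ht i
  have hw0 := h.wVal_le ht i
  have hu : uVal B i = wVal B (i + 1) := by
    rcases uVal_eq_or B i with h' | h' <;> linarith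
  rcases wVal_eq_or B i with h' | ⟨j, h'⟩
  · linarith
  · obtain ⟨k, hk⟩ := ha j
    have := aVal_ge_of_not_aOne (Nat.zero_le _) hk
    linarith

/-- A gap of `4 * 4 ^ (l + 1)` at level `l + 1` exceeds every exit cost, which is below `2 * 4 ^ (l
+ 1) + 2`, so no `b`-vertex of level `l` stays on course for `w`. Then `u` pays `4 ^ (l + 1)` and
`w` pays `2 * 4 ^ (l + 1)` to reach `u` of level `l + 1`, which leaves a gap of `4 ^ (l + 1)` for
the next level down. -/
lemma MultiStable.reset (h : MultiStable B) (ht : 0 < t) (hr : 0 < r) (hs : 0 < s) {i : ℕ}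
    (heq : wVal B i = uVal B i + 4 ^ (i + 1)) (l : Fin n) (hl : l < i) :
    ∀ j, ¬ BOne B l j := by
  have key : ∀ l : Fin n, wVal B (l + 1) = uVal B (l + 1) + 4 ^ ((l : ℕ) + 1 + 1) →
      (∀ j, ¬ BOne B l j) ∧ wVal B l = uVal B l + 4 ^ ((l : ℕ) + 1) := by
    intro l hl
    rw [pow_succ] at hl
    have hpos : (1 : ℝ) ≤ 4 ^ ((l : ℕ) + 1) := one_le_pow₀ (by norm_num)
    have hbs : ∀ j, ¬ BOne B l j := by
      intro j hj
      have h1 := bVal_of_bOne j.2.le fun j' hj' => h.bOne_of_le ht hj hj'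
      have h2 := h.bVal_le ht l j
      have := mul_eps_lt_one j.2
      linarith
    refine ⟨hbs, ?_⟩
    have hb := bVal_ge_of_not_bOne (Nat.zero_le _) (hbs ⟨0, Nat.mul_pos hr hs⟩)
    have hu0 := h.uVal_le ht l
    have hu : uVal B l = 4 ^ ((l : ℕ) + 1) + uVal B (l + 1) := by
      rcases uVal_eq_or B l with h' | h' <;> linarith
    have hw1 := h.wVal_le_aVal ht l ⟨0, hr⟩
    have ha1 := h.aVal_le ht l ⟨0, hr⟩ ⟨0, hs⟩
    simp only [Nat.cast_zero, zero_mul, add_zero] at ha1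
    have hge := aVal_zero_ge B l
    rw [min_eq_left (by linarith)] at hge
    rcases wVal_eq_or B l with h' | ⟨j, h'⟩
    · linarith
    · have := hge j
      linarith
  have all : ∀ d (l : Fin n), (l : ℕ) + 1 + d = i →
      (∀ j, ¬ BOne B l j) ∧ wVal B l = uVal B l + 4 ^ ((l : ℕ) + 1) := by
    intro d
    induction d with
    | zero =>
      rintro l rfl
      exact key l heq
    | succ d ih =>
      intro l hld
      refine key l ?_
      by_cases hln : (l : ℕ) + 1 < n
      · exact (ih ⟨l + 1, hln⟩ (by simp; omega)).2
      · have h1 := wVal_of_ge B (i := i) (by omega)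
        have h2 := uVal_of_ge B (i := i) (by omega)
        rw [h1, h2] at heq
        have : (0 : ℝ) < 4 ^ (i + 1) := by positivity
        linarith
  exact (all (i - (l + 1)) l (by omega)).1

end Stability

/-! ### Values depend only on the tree edges at the same and higher levels. -/

section Locality

variable {B B' : (graph n r s t).Tree}

lemma level_of_tgt (e : Edge n r s t) (v : Node n r s) (h : tgt e = some v) :
    level (src e) ≤ level v := by
  have hu : ∀ i : ℕ, uAt n r s (i + 1) = some v → i ≤ level v := by
    intro i h
    unfold uAt at h
    split_ifs at h
    cases h
    simp [level]
  have hw : ∀ i : ℕ, wAt n r s (i + 1) = some v → i ≤ level v := by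
    intro i h
    unfold wAt at h
    split_ifs at h
    cases h
    simp [level]
  have hb : ∀ (i : Fin n) (j : ℕ), bAt (r := r) (s := s) i j = some v → (i : ℕ) ≤ level v := by
    intro i j h
    unfold bAt at h
    split_ifs at h
    · cases h; simp [level]
    · exact hw i h
  have ha : ∀ (i : Fin n) (j : Fin r) (k : ℕ), aAt (s := s) i j k = some v →
      (i : ℕ) ≤ level v := by
    intro i j k h
    unfold aAt at h
    split_ifs at h
    · cases h; simp [level]
    · exact hb i 0 h
  cases e with
  | a1 i j k => exact ha i j _ h
  | a0 i j k l => exact hu i h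
  | b1 i j => exact hb i _ h
  | b0 i j l => exact hu i h
  | u1 i l => exact hb i _ h
  | u0 i l => exact hu i h
  | w1 i j l => exact ha i j _ h
  | w0 i l => exact hw i h

lemma value_congr_of_level {i : ℕ} (h : ∀ v, i < level v → B.1 v = B'.1 v) (v : Node n r s)
    (hv : i < level v) : value B (some v) = value B' (some v) :=
  value_congr_of_closed isRank_rank B B' (fun v => i < level v)
    (fun e v he hev => lt_of_lt_of_le he (level_of_tgt e v hev)) h v hv

lemma uVal_congr_of_level {i : ℕ} (h : ∀ v, i < level v → B.1 v = B'.1 v) :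
    uVal B (i + 1) = uVal B' (i + 1) := by
  unfold uVal uAt
  split_ifs
  · exact value_congr_of_level h _ (by simp [level])
  · simp

lemma wVal_congr_of_level {i : ℕ} (h : ∀ v, i < level v → B.1 v = B'.1 v) :
    wVal B (i + 1) = wVal B' (i + 1) := by
  unfold wVal wAt
  split_ifs
  · exact value_congr_of_level h _ (by simp [level])
  · simp

lemma isImproving_congr_of_level {i : ℕ} (h : ∀ v, i < level v → B.1 v = B'.1 v)
    (e : Edge n r s t) (he : i < level (src e)) : IsImproving B e ↔ IsImproving B' e := by
  unfold IsImproving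
  have h1 : value B (some ((graph n r s t).src e)) = value B' (some ((graph n r s t).src e)) :=
    value_congr_of_level h _ he
  have h2 : value B ((graph n r s t).tgt e) = value B' ((graph n r s t).tgt e) := by
    rcases hx : (graph n r s t).tgt e with _ | v
    · simp
    · exact value_congr_of_level h v (lt_of_lt_of_le he (level_of_tgt e v hx))
  rw [h1, h2]

end Locality

end BlandGraph

/-! ### Good bijections and the counting recursion for the run. -/

namespace BlandGraph

open TargetGraph

variable {n r s t : ℕ}

/-- The `l`-th parallel copy of a multi-edge; the identity on the other edges. -/
def copy (l : Fin t) : Edge n r s t → Edge n r s t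
  | .a1 i j k => .a1 i j k
  | .a0 i j k _ => .a0 i j k l
  | .b1 i j => .b1 i j
  | .b0 i j _ => .b0 i j l
  | .u1 i _ => .u1 i l
  | .u0 i _ => .u0 i l
  | .w1 i j _ => .w1 i j l
  | .w0 i _ => .w0 i l

/-- Every multi-edge has a copy with index at least `H`; every `a`-path has a one-edge with index
below `H`, on every level the one-edges of some `a`-path have indices at least `θ`, and the `b`-path
of every level has a one-edge with index below `θ`. -/
structure IsGood (σ : Edge n r s t ≃ Fin (Fintype.card (Edge n r s t))) (θ H : ℕ) : Prop where
  multi : ∀ e, IsMulti e → ∃ l, H ≤ (σ (copy l e) : ℕ)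
  a_low : ∀ i j, ∃ k, (σ (.a1 i j k) : ℕ) < H
  a_high : ∀ i, ∃ j, ∀ k, θ ≤ (σ (.a1 i j k) : ℕ)
  b_low : ∀ i, ∃ j, (σ (.b1 i j) : ℕ) < θ

/-- The smallest index of a one-edge on the `b`-path of a level. -/
noncomputable def bMin (σ : Edge n r s t ≃ Fin (Fintype.card (Edge n r s t))) (i : Fin n) : ℕ :=
  ⨅ j : Fin (r * s), (σ (.b1 i j) : ℕ)

/-- The subsets of `S` on which `β` is strictly decreasing with values at least `m`. -/
def decreasingSubsets {α : Type*} [LinearOrder α] (β : α → ℕ) (S : Finset α) (m : ℕ) :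
    Finset (Finset α) :=
  S.powerset.filter fun A => (∀ a ∈ A, m ≤ β a) ∧ ∀ a ∈ A, ∀ b ∈ A, a < b → β b < β a

lemma mem_decreasingSubsets {α : Type*} [LinearOrder α] {β : α → ℕ} {S A : Finset α} {m : ℕ} :
    A ∈ decreasingSubsets β S m ↔
      A ⊆ S ∧ (∀ a ∈ A, m ≤ β a) ∧ ∀ a ∈ A, ∀ b ∈ A, a < b → β b < β a := by
  simp [decreasingSubsets]

lemma decreasingSubsets_of_not_mem {α : Type*} [LinearOrder α] {β : α → ℕ} {S : Finset α} {m : ℕ}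
    (h : ∀ a ∈ S, β a ≠ m) : decreasingSubsets β S m ⊆ decreasingSubsets β S (m + 1) := by
  intro A hA
  rw [mem_decreasingSubsets] at hA ⊢
  refine ⟨hA.1, fun a ha => ?_, hA.2.2⟩
  have := hA.2.1 a ha
  have := h a (hA.1 ha)
  omega

/-- Since `m` is the least admissible value, a decreasing set containing `i` has `i` as its largest
element; removing `i` leaves a decreasing subset of the levels below `i`. -/
lemma card_decreasingSubsets_le {α : Type*} [LinearOrder α] {β : α → ℕ} (hβ : Function.Injective β)
    {S : Finset α} {m : ℕ} {i : α} (hi : β i = m) :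
    (decreasingSubsets β S m).card ≤ (decreasingSubsets β S (m + 1)).card +
      (decreasingSubsets β (S.filter (· < i)) (m + 1)).card := by
  have hsub : decreasingSubsets β S m ⊆ decreasingSubsets β S (m + 1) ∪
      (decreasingSubsets β (S.filter (· < i)) (m + 1)).image (insert i) := by
    intro A hA
    rw [mem_decreasingSubsets] at hA
    obtain ⟨hAS, hm, hd⟩ := hA
    have hne : ∀ a ∈ A, a ≠ i → m + 1 ≤ β a := fun a ha hai => by
      have := hm a ha
      have : β a ≠ m := fun h => hai (hβ (h.trans hi.symm))
      omega
    rw [Finset.mem_union]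
    by_cases hiA : i ∈ A
    · right
      refine Finset.mem_image.2 ⟨A.erase i, mem_decreasingSubsets.2 ⟨fun a ha => ?_,
        fun a ha => ?_, fun a ha b hb => ?_⟩, Finset.insert_erase hiA⟩
      · obtain ⟨hai, ha⟩ := Finset.mem_erase.1 ha
        refine Finset.mem_filter.2 ⟨hAS ha, lt_of_le_of_ne (not_lt.1 fun hlt => ?_) hai⟩
        have h1 := hd i hiA a ha hlt
        have := hm a ha
        omega
      · exact hne a (Finset.mem_of_mem_erase ha) (Finset.ne_of_mem_erase ha)
      · exact hd a (Finset.mem_of_mem_erase ha) b (Finset.mem_of_mem_erase hb)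
    · left
      exact mem_decreasingSubsets.2 ⟨hAS, fun a ha => hne a ha fun h => hiA (h ▸ ha), hd⟩
  calc _ ≤ _ := Finset.card_le_card hsub
    _ ≤ _ := Finset.card_union_le _ _
    _ ≤ _ := Nat.add_le_add_left Finset.card_image_le _

section Run

variable {σ : Edge n r s t ≃ Fin (Fintype.card (Edge n r s t))} {θ H : ℕ}

lemma bMin_le (σ : Edge n r s t ≃ Fin (Fintype.card (Edge n r s t))) (i : Fin n)
    (j : Fin (r * s)) : bMin σ i ≤ σ (.b1 i j) :=
  Nat.sInf_le ⟨j, rfl⟩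

lemma exists_bMin (hrs : 0 < r * s) (σ : Edge n r s t ≃ Fin (Fintype.card (Edge n r s t)))
    (i : Fin n) : ∃ j, (σ (.b1 i j) : ℕ) = bMin σ i := by
  have : Nonempty (Fin (r * s)) := ⟨⟨0, hrs⟩⟩
  exact Nat.sInf_mem (Set.range_nonempty fun j : Fin (r * s) => (σ (.b1 i j) : ℕ))

lemma bMin_injective (hrs : 0 < r * s)
    (σ : Edge n r s t ≃ Fin (Fintype.card (Edge n r s t))) : Function.Injective (bMin σ) := by
  intro i i' h
  obtain ⟨j, hj⟩ := exists_bMin hrs σ i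
  obtain ⟨j', hj'⟩ := exists_bMin hrs σ i'
  have := σ.injective (Fin.ext (hj.trans (h.trans hj'.symm)))
  cases this
  rfl

lemma isImproving_copy (B : (graph n r s t).Tree) (l : Fin t) (e : Edge n r s t) :
    IsImproving B (copy l e) ↔ IsImproving B e := by
  cases e <;> rfl

lemma IsGood.multiStable (h : IsGood σ θ H) {B : (graph n r s t).Tree} (hB : Stable σ H B) :
    MultiStable B := fun e he hi => by
  obtain ⟨l, hl⟩ := h.multi e he
  exact hB _ hl ((isImproving_copy B l e).2 hi)

lemma IsGood.aStable (h : IsGood σ θ H) (hθ : θ ≤ H) {B : (graph n r s t).Tree}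
    (hB : Stable σ θ B) : AStable B :=
  ⟨h.multiStable (hB.mono hθ), fun i => (h.a_high i).imp fun _ hj k => hB _ (hj k)⟩

/-- The invariant of the run of Bland's rule that begins with the switch to the one-edge at
position `p` of the `b`-path of level `i` in the tree `B₀`. -/
structure RunInvariant (σ : Edge n r s t ≃ Fin (Fintype.card (Edge n r s t))) (H : ℕ)
    (B₀ : (graph n r s t).Tree) (i : Fin n) (p : Fin (r * s)) (B : (graph n r s t).Tree) :
    Prop where
  upper : ∀ v, (i : ℕ) < level v → B.1 v = B₀.1 v
  ones : ∀ j, p ≤ j → BOne B i j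
  a_path : (¬ Full B i ∧ AZero B i) ∨
    (Full B i ∧ ∀ j k, (σ (.a1 i j k) : ℕ) < H → ¬ AOne B i j k)

variable {B₀ B : (graph n r s t).Tree} {i : Fin n} {p : Fin (r * s)} {m : ℕ}

/-- From position `q` on, the path is free to `w` of the next level, which is worth as much as `u`;
hence no zero-edge improves there. -/
lemma bOne_switch {e : Edge n r s t} (he : IsImproving B e)
    (heq : uVal B (i + 1) = wVal B (i + 1)) {q : ℕ} (h : ∀ j : Fin (r * s), q ≤ j → BOne B i j)
    (j : Fin (r * s)) (hj : q ≤ j) : BOne (switch B e) i j := by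
  rcases switch_apply_eq_or B e (.b i j) with h1 | ⟨h1, h2⟩
  · exact h1.trans (h j hj)
  · refine h2.trans ?_
    rcases e with _ | _ | ⟨i', j'⟩ | ⟨i', j', l⟩ | _ | _ | _ | _ <;> simp [graph, src] at h1
    · obtain ⟨rfl, rfl⟩ := h1
      rfl
    · obtain ⟨rfl, rfl⟩ := h1
      rw [improving_b0, bVal_of_bOne j.2.le fun j'' hj'' => h j'' (by omega), heq] at he
      have := eps_pos j.2
      have : (0 : ℝ) < 4 ^ ((i : ℕ) + 1) := by positivity
      nlinarith [Nat.cast_nonneg (α := ℝ) (j : ℕ)]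

lemma aOne_switch {e : Edge n r s t} {j : Fin r} {k : Fin s} (h : AOne (switch B e) i j k) :
    AOne B i j k ∨ e = .a1 i j k := by
  rcases switch_apply_eq_or B e (.a i j k) with h1 | ⟨-, h2⟩
  · exact Or.inl (h1.symm.trans h)
  · exact Or.inr (h2.symm.trans h)

/-- While the `b`-path is not full, one-edges of the `a`-paths do not improve. Once it is full,
switches of index at least `H` take precedence, so the blocking `a`-edges of index below `H` stay
out until threshold `H` is stable. -/
lemma RunInvariant.blandStep (h : RunInvariant σ H B₀ i p B)
    (heq : uVal B₀ (i + 1) = wVal B₀ (i + 1)) (h₀ : Stable σ m B₀) (hm : ¬ Stable σ m B)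
    (hH : ¬ (Stable σ H B ∧ Full B i)) : RunInvariant σ H B₀ i p (blandStep σ B) := by
  obtain ⟨e, he, hme, hmax, hstep⟩ := blandStep_of_not_stable hm
  rw [hstep]
  -- A switch above level `i` would already have improved `B₀`, which agrees with `B` there and is
  -- stable for `m`.
  have hlev : level (src e) ≤ (i : ℕ) := by
    by_contra hlt
    exact h₀ e hme ((isImproving_congr_of_level h.upper e (not_le.1 hlt)).1 he)
  have heqB : uVal B (i + 1) = wVal B (i + 1) := by
    rw [uVal_congr_of_level h.upper, wVal_congr_of_level h.upper, heq]
  refine ⟨fun v hv => ?_, fun j hj => ?_, ?_⟩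
  · rw [switch_apply_ne B e (fun hve => ?_), h.upper v hv]
    rw [hve] at hv
    exact absurd hlev (not_le.2 hv)
  · exact bOne_switch he heqB (q := p) (fun j' hj' => h.ones j' hj') j hj
  · rcases h.a_path with ⟨hf, ha⟩ | ⟨hf, ha⟩
    · have hz : AZero (switch B e) i := fun j k hone => by
        rcases aOne_switch hone with h1 | rfl
        · exact ha j k h1
        · exact ha.not_improving_a1 hf j k he
      by_cases hf' : Full (switch B e) i
      · exact Or.inr ⟨hf', fun j k _ => hz j k⟩
      · exact Or.inl ⟨hf', hz⟩
    · refine Or.inr ⟨fun j => bOne_switch he heqB (q := 0) (fun j' _ => hf j') j (Nat.zero_le _),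
        fun j k hjk hone => ?_⟩
      rcases aOne_switch hone with h1 | rfl
      · exact ha j k hjk h1
      · have hns : ¬ Stable σ H B := fun h' => hH ⟨h', hf⟩
        obtain ⟨f, hf1, hf2, -⟩ := blandStep_of_not_stable hns
        exact absurd (hf2.trans (Fin.le_def.1 (hmax f hf1))) (not_le.2 hjk)

lemma runInvariant_switch (ht : 0 < t) (h₀ : AStable B₀) (hp : ¬ BOne B₀ i p)
    (hones : ∀ j, p < j → BOne B₀ i j) :
    RunInvariant σ H B₀ i p (switch B₀ (.b1 i p)) := by
  have hne : ∀ v, v ≠ .b i p → (switch B₀ (.b1 i p)).1 v = B₀.1 v := fun v hv =>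
    switch_apply_ne B₀ _ hv
  refine ⟨fun v hv => hne v ?_, fun j hj => ?_, ?_⟩
  · rintro rfl
    exact lt_irrefl _ hv
  · rcases eq_or_lt_of_le hj with rfl | hlt
    · exact switch_apply_src B₀ _
    · refine (hne _ ?_).trans (hones j hlt)
      simp only [ne_eq, Node.b.injEq, true_and]
      exact hlt.ne'
  · have hz : AZero (switch B₀ (.b1 i p)) i := fun j k hone =>
      h₀.1.aZero ht (fun hf => hp (hf p)) j k ((hne _ (by simp)).symm.trans hone)
    by_cases hf : Full (switch B₀ (.b1 i p)) i
    · exact Or.inr ⟨hf, fun j k _ => hz j k⟩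
    · exact Or.inl ⟨hf, hz⟩

/-- Otherwise the front edge of level `i` improves. Stability forces its index down to `bMin σ i`,
so it is the edge at `p`, which is already in the tree. -/
lemma RunInvariant.full (h : RunInvariant σ H B₀ i p B) (hg : IsGood σ θ H) (hθ : θ ≤ H)
    (ht : 0 < t) (hp : (σ (.b1 i p) : ℕ) = bMin σ i) (hm : bMin σ i < θ)
    (hB : Stable σ (bMin σ i + 1) B) : Full B i := by
  by_contra hf
  obtain ⟨j, hj, -, hji⟩ := (hg.aStable hθ (hB.mono hm)).exists_front ht hf
  have h1 : (σ (.b1 i j) : ℕ) < bMin σ i + 1 := not_le.1 fun h' => hB _ h' hji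
  have h2 := bMin_le σ i j
  have h3 : (Edge.b1 i j : Edge n r s t) = .b1 i p := σ.injective (Fin.ext (by omega))
  cases h3
  exact hj (h.ones _ le_rfl)

/-- After the last missing one-edge of the `b`-path of a level has been added, the `b`-paths of all
lower levels are reset. -/
lemma exists_reset (hg : IsGood σ θ H) (hθ : θ ≤ H) (ht : 0 < t) (hr : 0 < r) (hs : 0 < s)
    (hp : (σ (.b1 i p) : ℕ) = bMin σ i) (hm : bMin σ i < θ)
    (h₀ : Stable σ (bMin σ i + 1) B₀) (hp₀ : ¬ BOne B₀ i p) (hones : ∀ j, p < j → BOne B₀ i j)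
    (q : ℕ) (hq : Stable σ (bMin σ i + 1) ((blandStep σ)^[q] (switch B₀ (.b1 i p)))) :
    ∃ q' ≤ q, ∀ l < i, ∀ j, ¬ BOne ((blandStep σ)^[q'] (switch B₀ (.b1 i p))) l j := by
  have hA₀ := hg.aStable hθ (h₀.mono hm)
  have heq := hA₀.uVal_eq_wVal ht (i + 1)
  -- Stop when the level is full and threshold `H` is stable, before any blocking `a`-edge can
  -- enter. The other stopping condition only guarantees that a stopping time exists; it implies the
  -- same two properties.
  obtain ⟨q', hqq, hI, hP⟩ := exists_first_time (blandStep σ)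
    (fun B => Stable σ (bMin σ i + 1) B ∨ (Stable σ H B ∧ Full B i))
    (RunInvariant σ H B₀ i p) _ (runInvariant_switch ht hA₀ hp₀ hones)
    (fun B hB hn => by
      rw [not_or] at hn
      exact hB.blandStep heq h₀ hn.1 hn.2) q (Or.inl hq)
  refine ⟨q', hqq, ?_⟩
  generalize (blandStep σ)^[q'] (switch B₀ (.b1 i p)) = B at hI hP
  have hHF : Stable σ H B ∧ Full B i := by
    rcases hP with hP | hP
    · exact ⟨hP.mono (by omega), hI.full hg hθ ht hp hm hP⟩
    · exact hP
  have hms := hg.multiStable hHF.1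
  have ha : ∀ j, ∃ k, ¬ AOne B i j k := fun j => by
    rcases hI.a_path with ⟨hf, -⟩ | ⟨-, ha⟩
    · exact absurd hHF.2 hf
    · exact (hg.a_low i j).imp fun k hk => ha j k hk
  have hgap := hms.wVal_sub_uVal_of_full ht hHF.2 (by
    rw [uVal_congr_of_level hI.upper, wVal_congr_of_level hI.upper, heq]) ha
  exact fun l hl => hms.reset ht hr hs hgap l hl

/-- The number of steps until no improving switch with index at least `m` is left. -/
lemma card_decreasingSubsets_le_of_stable (hg : IsGood σ θ H) (hθ : θ ≤ H) (ht : 0 < t)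
    (hr : 0 < r) (hs : 0 < s) {m : ℕ} (hm : m ≤ θ) (S : Finset (Fin n))
    (B : (graph n r s t).Tree)
    (hS : ∀ i ∈ S, ∀ j, (σ (.b1 i j) : ℕ) = bMin σ i → ¬ BOne B i j) (q : ℕ)
    (hq : Stable σ m ((blandStep σ)^[q] B)) :
    (decreasingSubsets (bMin σ) S m).card ≤ q + 1 := by
  have hrs := Nat.mul_pos hr hs
  obtain ⟨d, hd⟩ : ∃ d, θ = m + d := ⟨θ - m, by omega⟩
  induction d generalizing m S B q with
  | zero =>
    obtain rfl : θ = m := by omega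
    -- By `b_low` every `bMin σ i` is below `θ`, so only the empty set is counted.
    have : decreasingSubsets (bMin σ) S θ ⊆ {∅} := by
      intro A hA
      rw [mem_decreasingSubsets] at hA
      rw [Finset.mem_singleton, Finset.eq_empty_iff_forall_notMem]
      intro i hi
      obtain ⟨j, hj⟩ := hg.b_low i
      have := bMin_le σ i j
      have := hA.2.1 i hi
      omega
    have := Finset.card_le_card this
    simp at this
    omega
  | succ d ih =>
    by_cases hex : ∃ i ∈ S, bMin σ i = m
    swap
    · push Not at hex
      exact (Finset.card_le_card (decreasingSubsets_of_not_mem hex)).trans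
        (ih (m := m + 1) (by omega) S B hS q (hq.mono (by omega)) (by omega))
    obtain ⟨i, hiS, rfl⟩ := hex
    have hcard := card_decreasingSubsets_le (bMin_injective hrs σ) (S := S) (i := i) rfl
    obtain ⟨p, hp⟩ := exists_bMin hrs σ i
    -- First phase: until threshold `bMin σ i + 1` is stable, the edge at `p` has too small an index
    -- to be switched in.
    obtain ⟨q₁, hq₁, hI, hstab⟩ := exists_first_time (blandStep σ) (Stable σ (bMin σ i + 1))
      (fun B => ¬ BOne B i p) B (hS i hiS p hp)
      (fun B hB hn => by
        obtain ⟨e, -, hme, -, hstep⟩ := blandStep_of_not_stable hn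
        rw [hstep]
        intro hone
        rcases switch_apply_eq_or B e (.b i p) with h1 | ⟨-, h2⟩
        · exact hB (h1.symm.trans hone)
        · have : e = .b1 i p := h2.symm.trans hone
          rw [this] at hme
          omega) q (hq.mono (by omega))
    have hfirst := ih (m := bMin σ i + 1) (by omega) S B hS q₁ hstab (by omega)
    obtain ⟨q₂, rfl⟩ : ∃ q₂, q = q₂ + q₁ := ⟨q - q₁, by omega⟩
    rw [Function.iterate_add_apply] at hq
    generalize (blandStep σ)^[q₁] B = B₁ at hI hstab hq
    have hA₁ := hg.aStable hθ (hstab.mono (by omega))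
    obtain ⟨p', hp', hones, himp⟩ := hA₁.exists_front ht fun hf => hI (hf p)
    obtain rfl : p' = p := by
      have h1 : (σ (.b1 i p') : ℕ) < bMin σ i + 1 := not_le.1 fun h' => hstab _ h' himp
      have h2 := bMin_le σ i p'
      have h3 : (Edge.b1 i p' : Edge n r s t) = .b1 i p := σ.injective (Fin.ext (by omega))
      cases h3
      rfl
    have hns : ¬ Stable σ (bMin σ i) B₁ := fun h' => h' _ hp.ge himp
    obtain ⟨e, he, hme, -, hstep⟩ := blandStep_of_not_stable hns
    -- No improving switch has a larger index, so the next step performs exactly this one.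
    obtain rfl : e = .b1 i p' := by
      have h1 : (σ e : ℕ) < bMin σ i + 1 := not_le.1 fun h' => hstab _ h' he
      exact σ.injective (Fin.ext (by omega))
    obtain ⟨q₃, rfl⟩ : ∃ q₃, q₂ = q₃ + 1 := by
      rcases q₂ with _ | q₃
      · exact absurd hq hns
      · exact ⟨q₃, rfl⟩
    rw [Function.iterate_succ_apply, hstep] at hq
    obtain ⟨q₄, hq₄, hreset⟩ := exists_reset hg hθ ht hr hs hp (by omega) hstab hp' hones q₃
      (hq.mono (by omega))
    obtain ⟨q₅, rfl⟩ : ∃ q₅, q₃ = q₅ + q₄ := ⟨q₃ - q₄, by omega⟩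
    rw [Function.iterate_add_apply] at hq
    -- Second phase: after the reset the levels below `i` satisfy the hypothesis on the starting
    -- tree again.
    have hsecond := ih (m := bMin σ i + 1) (by omega) (S.filter (· < i)) _
      (fun l hl j _ => hreset l (Finset.mem_filter.1 hl).2 j) q₅ (hq.mono (by omega)) (by omega)
    -- The two phases contribute `q₁ + 1` and `q₅ + 1`; the switch between them pays for the surplus
    -- `1`.
    omega

lemma card_decreasingSubsets_le_blandSwitches (hg : IsGood σ θ H) (hθ : θ ≤ H) (ht : 0 < t)
    (hr : 0 < r) (hs : 0 < s) (hB : IsInitialTree B) :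
    (decreasingSubsets (bMin σ) Finset.univ 0).card ≤ blandSwitches σ B + 1 :=
  card_decreasingSubsets_le_of_stable hg hθ ht hr hs (Nat.zero_le _) _ B
    (fun i _ j _ hone => by
      have := hB (.b i j)
      unfold BOne at hone
      rw [hone] at this
      exact this) _ (stable_blandSwitches isRank_rank σ B)

end Run

end BlandGraph

/-! ### Probability that a random bijection maps a set into another set. -/

section Counting

variable {E : Type*} [Fintype E] [DecidableEq E] {M : ℕ}

/-- The bijections from `E` to `Fin M` that map the set `X` into the set `F`. -/
def mapsInto (X : Finset E) (F : Finset (Fin M)) : Finset (E ≃ Fin M) :=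
  Finset.univ.filter fun σ => ∀ x ∈ X, σ x ∈ F

lemma mem_mapsInto {X : Finset E} {F : Finset (Fin M)} {σ : E ≃ Fin M} :
    σ ∈ mapsInto X F ↔ ∀ x ∈ X, σ x ∈ F := by simp [mapsInto]

/-- Precomposing with the transposition of `x` and `y` exchanges the two conditions. -/
lemma card_mapsInto_insert (X : Finset E) (F : Finset (Fin M)) {x y : E} (hx : x ∉ X)
    (hy : y ∉ X) : (mapsInto (insert x X) F).card ≤ (mapsInto (insert y X) F).card := by
  refine Finset.card_le_card_of_injOn (fun σ => (Equiv.swap x y).trans σ) (fun σ hσ => ?_)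
    (fun σ _ τ _ h => ?_)
  · rw [Finset.mem_coe, mem_mapsInto] at hσ ⊢
    intro z hz
    rcases Finset.mem_insert.1 hz with rfl | hz
    · simpa using hσ x (Finset.mem_insert_self _ _)
    · have hzx : z ≠ x := fun h => hx (h ▸ hz)
      have hzy : z ≠ y := fun h => hy (h ▸ hz)
      simpa [Equiv.swap_apply_of_ne_of_ne hzx hzy] using hσ z (Finset.mem_insert_of_mem hz)
  · ext z
    have := congrArg (fun e : E ≃ Fin M => (e (Equiv.swap x y z) : ℕ)) h
    simpa using this

lemma card_filter_notMem_of_mapsInto (X : Finset E) (F : Finset (Fin M)) {σ : E ≃ Fin M}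
    (hσ : σ ∈ mapsInto X F) : (Xᶜ.filter fun y => σ y ∈ F).card + X.card = F.card := by
  rw [mem_mapsInto] at hσ
  have h1 : (Xᶜ.filter fun y => σ y ∈ F) = (F.map σ.symm.toEmbedding) \ X := by
    ext y
    simp only [Finset.mem_filter, Finset.mem_compl, Finset.mem_sdiff, Finset.mem_map_equiv,
      Equiv.symm_symm]
    tauto
  have h2 : X ⊆ F.map σ.symm.toEmbedding := fun x hx => by
    rw [Finset.mem_map_equiv, Equiv.symm_symm]
    exact hσ x hx
  rw [h1, Finset.card_sdiff_add_card_eq_card h2, Finset.card_map]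

/-- Given that `X` is mapped into `F`, a further element lands in `F` with probability `(|F| - |X|)
/ (M - |X|) ≤ |F| / M`. The proof counts pairs of a bijection and an element outside `X` mapped into
`F`. -/
lemma card_mapsInto_mul_le (hM : Fintype.card E = M) (X : Finset E) (F : Finset (Fin M)) {x : E}
    (hx : x ∉ X) :
    (mapsInto (insert x X) F).card * M ≤ (mapsInto X F).card * F.card := by
  classical
  have hcount : ∑ y ∈ Xᶜ, (mapsInto (insert y X) F).card =
      ∑ σ ∈ mapsInto X F, (Xᶜ.filter fun y => σ y ∈ F).card := by
    refine Eq.trans ?_ (Finset.sum_card_bipartiteAbove_eq_sum_card_bipartiteBelow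
      (s := mapsInto X F) (t := Xᶜ) (fun σ y => σ y ∈ F)).symm
    refine Finset.sum_congr rfl fun y _ => congrArg _ ?_
    ext σ
    simp only [Finset.mem_bipartiteBelow, mem_mapsInto, Finset.mem_insert, forall_eq_or_imp]
    tauto
  have hlow : Xᶜ.card * (mapsInto (insert x X) F).card ≤
      ∑ y ∈ Xᶜ, (mapsInto (insert y X) F).card := by
    rw [← smul_eq_mul]
    exact Finset.card_nsmul_le_sum _ _ _ fun y hy =>
      card_mapsInto_insert X F hx (Finset.mem_compl.1 hy)
  have hup : ∑ σ ∈ mapsInto X F, ((Xᶜ.filter fun y => σ y ∈ F).card + X.card) =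
      (mapsInto X F).card * F.card := by
    rw [Finset.sum_congr rfl fun σ hσ => card_filter_notMem_of_mapsInto X F hσ]
    simp
  rw [Finset.sum_add_distrib, ← hcount, Finset.sum_const, smul_eq_mul] at hup
  have hXM : Xᶜ.card + X.card = M := by rw [Finset.card_compl_add_card, hM]
  have hXpos : 0 < Xᶜ.card := Finset.card_pos.2 ⟨x, Finset.mem_compl.2 hx⟩
  have hFM : F.card ≤ M := by simpa using Finset.card_le_univ F
  generalize (mapsInto (insert x X) F).card = N' at *
  generalize (mapsInto X F).card = N at *
  generalize Xᶜ.card = c at *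
  generalize X.card = d at *
  generalize F.card = f at *
  have h1 : c * N' + N * d ≤ N * f := by omega
  refine Nat.le_of_mul_le_mul_left ?_ hXpos
  have h2 : c * N' * M + N * d * M ≤ N * f * M := by
    rw [← add_mul]; exact Nat.mul_le_mul_right _ h1
  have h3 : N * d * f ≤ N * d * M := Nat.mul_le_mul_left _ hFM
  have h4 : N * f * M = c * (N * f) + N * d * f := by rw [← hXM]; ring
  calc c * (N' * M) = c * N' * M := by ring
    _ ≤ c * (N * f) := by omega

lemma card_mapsInto_mul_pow_le (hM : Fintype.card E = M) (X : Finset E) (F : Finset (Fin M)) :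
    (mapsInto X F).card * M ^ X.card ≤ Fintype.card (E ≃ Fin M) * F.card ^ X.card := by
  induction X using Finset.induction_on with
  | empty => simpa using Finset.card_le_univ _
  | insert x X hx ih =>
    rw [Finset.card_insert_of_notMem hx, pow_succ, pow_succ]
    calc (mapsInto (insert x X) F).card * (M ^ X.card * M)
        = (mapsInto (insert x X) F).card * M * M ^ X.card := by ring
      _ ≤ (mapsInto X F).card * F.card * M ^ X.card :=
        Nat.mul_le_mul_right _ (card_mapsInto_mul_le hM X F hx)
      _ = (mapsInto X F).card * M ^ X.card * F.card := by ring
      _ ≤ Fintype.card (E ≃ Fin M) * F.card ^ X.card * F.card := Nat.mul_le_mul_right _ ih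
      _ = _ := by ring

/-- The probability that a random bijection maps `X` into `F`. -/
lemma card_mapsInto_le (hM : Fintype.card E = M) (hpos : 0 < M) (X : Finset E)
    (F : Finset (Fin M)) {p : ℝ} (hp : (F.card : ℝ) ≤ p * M) :
    ((mapsInto X F).card : ℝ) ≤ Fintype.card (E ≃ Fin M) * p ^ X.card := by
  have h := card_mapsInto_mul_pow_le hM X F
  have h' : ((mapsInto X F).card : ℝ) * (M : ℝ) ^ X.card ≤
      Fintype.card (E ≃ Fin M) * (F.card : ℝ) ^ X.card := by exact_mod_cast h
  have hM' : (0 : ℝ) < (M : ℝ) ^ X.card := by positivity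
  have h2 : (F.card : ℝ) ^ X.card ≤ p ^ X.card * (M : ℝ) ^ X.card := by
    rw [← mul_pow]
    exact pow_le_pow_left₀ (Nat.cast_nonneg _) hp _
  refine le_of_mul_le_mul_right ?_ hM'
  calc _ ≤ _ := h'
    _ ≤ _ := mul_le_mul_of_nonneg_left h2 (Nat.cast_nonneg _)
    _ = _ := by ring

end Counting

namespace BlandGraph

open TargetGraph

variable {n r s t : ℕ}

/-! ### Permuting levels, and the expectation in terms of decreasing sets. -/

section Symmetry

/-- The map on edges that applies a function to the levels. -/
def mapLevel (ρ : Fin n → Fin n) : Edge n r s t → Edge n r s t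
  | .a1 i j k => .a1 (ρ i) j k
  | .a0 i j k l => .a0 (ρ i) j k l
  | .b1 i j => .b1 (ρ i) j
  | .b0 i j l => .b0 (ρ i) j l
  | .u1 i l => .u1 (ρ i) l
  | .u0 i l => .u0 (ρ i) l
  | .w1 i j l => .w1 (ρ i) j l
  | .w0 i l => .w0 (ρ i) l

/-- The permutation of the edges that is induced by a permutation of the levels. -/
def permLevel (ρ : Equiv.Perm (Fin n)) : Edge n r s t ≃ Edge n r s t where
  toFun := mapLevel ρ
  invFun := mapLevel ρ.symm
  left_inv e := by cases e <;> simp [mapLevel]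
  right_inv e := by cases e <;> simp [mapLevel]

variable {σ : Edge n r s t ≃ Fin (Fintype.card (Edge n r s t))} {θ H : ℕ}

lemma IsGood.permLevel (h : IsGood σ θ H) (ρ : Equiv.Perm (Fin n)) :
    IsGood ((permLevel ρ).trans σ) θ H where
  multi e he := by
    obtain ⟨l, hl⟩ := h.multi (mapLevel ρ e) (by cases e <;> exact he)
    refine ⟨l, ?_⟩
    have : BlandGraph.permLevel ρ (copy l e) = copy l (mapLevel ρ e) := by cases e <;> rfl
    rwa [Equiv.trans_apply, this]
  a_low i j := h.a_low (ρ i) j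
  a_high i := h.a_high (ρ i)
  b_low i := h.b_low (ρ i)

lemma bMin_permLevel (σ : Edge n r s t ≃ Fin (Fintype.card (Edge n r s t)))
    (ρ : Equiv.Perm (Fin n)) (i : Fin n) : bMin ((permLevel ρ).trans σ) i = bMin σ (ρ i) := rfl

/-- An injective function can be made strictly decreasing on a set by permuting the set. -/
lemma exists_perm_strictAnti {α : Type*} [LinearOrder α] (A : Finset α) {β : α → ℕ}
    (hβ : Function.Injective β) :
    ∃ ρ : Equiv.Perm A, ∀ a b : A, a < b → β (ρ b) < β (ρ a) := by
  let φ := A.orderIsoOfFin rfl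
  -- Sorting in the order dual yields decreasing values.
  let f : Fin A.card → ℕᵒᵈ := fun q => OrderDual.toDual (β (φ q))
  have hmono : Monotone (f ∘ Tuple.sort f) := Tuple.monotone_sort f
  refine ⟨(φ.toEquiv.symm.trans (Tuple.sort f)).trans φ.toEquiv, fun a b hab => ?_⟩
  have h1 := hmono (φ.symm.monotone hab.le)
  refine lt_of_le_of_ne h1 fun h => hab.ne ?_
  have := Subtype.ext (hβ h)
  simpa using this.symm

open Classical in
/-- Among the good bijections, a fraction of at least `1 / |A|!` is decreasing on a set `A` of
levels. -/
lemma card_good_le (hrs : 0 < r * s) (A : Finset (Fin n)) (θ H : ℕ) :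
    (Finset.univ.filter fun σ : Edge n r s t ≃ Fin (Fintype.card (Edge n r s t)) =>
      IsGood σ θ H).card ≤
    A.card.factorial *
      (Finset.univ.filter fun σ : Edge n r s t ≃ Fin (Fintype.card (Edge n r s t)) =>
        IsGood σ θ H ∧ A ∈ decreasingSubsets (bMin σ) Finset.univ 0).card := by
  set T := Finset.univ.filter fun σ : Edge n r s t ≃ Fin (Fintype.card (Edge n r s t)) =>
    IsGood σ θ H ∧ A ∈ decreasingSubsets (bMin σ) Finset.univ 0 with hT
  let g : Equiv.Perm A → (Edge n r s t ≃ Fin (Fintype.card (Edge n r s t))) →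
      (Edge n r s t ≃ Fin (Fintype.card (Edge n r s t))) :=
    fun ρ σ => (permLevel (Equiv.Perm.ofSubtype ρ)).symm.trans σ
  -- Each good bijection becomes decreasing on `A` after some permutation of `A`, so `|A|!` images
  -- of `T` cover all good bijections.
  have hsub : (Finset.univ.filter fun σ : Edge n r s t ≃ Fin (Fintype.card (Edge n r s t)) =>
      IsGood σ θ H) ⊆ (Finset.univ : Finset (Equiv.Perm A)).biUnion fun ρ => T.image (g ρ) := by
    intro σ hσ
    have hσ : IsGood σ θ H := (Finset.mem_filter.1 hσ).2
    obtain ⟨ρ, hρ⟩ := exists_perm_strictAnti A (bMin_injective hrs σ)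
    refine Finset.mem_biUnion.2 ⟨ρ, Finset.mem_univ _, Finset.mem_image.2
      ⟨(permLevel (Equiv.Perm.ofSubtype ρ)).trans σ, ?_, ?_⟩⟩
    · rw [hT, Finset.mem_filter, mem_decreasingSubsets]
      refine ⟨Finset.mem_univ _, hσ.permLevel _, Finset.subset_univ _,
        fun _ _ => Nat.zero_le _, fun a ha b hb hab => ?_⟩
      rw [bMin_permLevel, bMin_permLevel, Equiv.Perm.ofSubtype_apply_of_mem _ ha,
        Equiv.Perm.ofSubtype_apply_of_mem _ hb]
      exact hρ ⟨a, ha⟩ ⟨b, hb⟩ hab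
    · ext e
      simp [g]
  calc _ ≤ _ := Finset.card_le_card hsub
    _ ≤ ∑ ρ : Equiv.Perm A, (T.image (g ρ)).card := Finset.card_biUnion_le
    _ ≤ ∑ ρ : Equiv.Perm A, T.card := Finset.sum_le_sum fun ρ _ => Finset.card_image_le
    _ = A.card.factorial * T.card := by
      rw [Finset.sum_const, Finset.card_univ, Fintype.card_perm, Fintype.card_coe, smul_eq_mul]

open Classical in
/-- The expected number of improving switches is large when a large fraction of all bijections is
good. -/
lemma expectedBlandSwitches_ge (hr : 0 < r) (hs : 0 < s) (ht : 0 < t) {θ H : ℕ} (hθ : θ ≤ H)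
    {B : (graph n r s t).Tree} (hB : IsInitialTree B) (q : ℕ)
    (hgood : (Fintype.card (Edge n r s t ≃ Fin (Fintype.card (Edge n r s t))) : ℝ) ≤
      2 * (Finset.univ.filter fun σ : Edge n r s t ≃ Fin (Fintype.card (Edge n r s t)) =>
        IsGood σ θ H).card) :
    (n.choose q : ℝ) / q.factorial / 2 - 1 ≤ expectedBlandSwitches B := by
  set P := Edge n r s t ≃ Fin (Fintype.card (Edge n r s t))
  set Gd := Finset.univ.filter fun σ : P => IsGood σ θ H with hGd
  have hN : (0 : ℝ) < Fintype.card P := by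
    exact_mod_cast Fintype.card_pos_iff.2 ⟨Fintype.equivFin _⟩
  have hfac : (0 : ℝ) < q.factorial := by exact_mod_cast q.factorial_pos
  have h1 : n.choose q * Gd.card ≤
      q.factorial * ∑ σ ∈ Gd, (decreasingSubsets (bMin σ) Finset.univ 0).card := by
    have hA : ∀ A ∈ Finset.powersetCard q (Finset.univ : Finset (Fin n)), Gd.card ≤
        q.factorial * (Gd.filter fun σ => A ∈ decreasingSubsets (bMin σ) Finset.univ 0).card := by
      intro A hA
      have := card_good_le (t := t) (Nat.mul_pos hr hs) A θ H
      rw [(Finset.mem_powersetCard.1 hA).2] at this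
      rwa [hGd, Finset.filter_filter]
    have hsum := Finset.card_nsmul_le_sum _ _ _ hA
    rw [Finset.card_powersetCard, Finset.card_univ, Fintype.card_fin, smul_eq_mul,
      ← Finset.mul_sum] at hsum
    refine hsum.trans (Nat.mul_le_mul_left _ ?_)
    have := Finset.sum_card_bipartiteAbove_eq_sum_card_bipartiteBelow
      (s := Finset.powersetCard q (Finset.univ : Finset (Fin n))) (t := Gd)
      (fun A σ => A ∈ decreasingSubsets (bMin σ) Finset.univ 0)
    refine this.le.trans (Finset.sum_le_sum fun σ _ => Finset.card_le_card fun A hA => ?_)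
    exact ((Finset.mem_bipartiteBelow _).1 hA).2
  have h2 : ∑ σ ∈ Gd, ((decreasingSubsets (bMin σ) Finset.univ 0).card : ℝ) ≤
      (∑ σ : P, (blandSwitches σ B : ℝ)) + Fintype.card P := by
    calc _ ≤ ∑ σ ∈ Gd, ((blandSwitches σ B : ℝ) + 1) := Finset.sum_le_sum fun σ hσ => by
          exact_mod_cast card_decreasingSubsets_le_blandSwitches (Finset.mem_filter.1 hσ).2
            hθ ht hr hs hB
      _ ≤ ∑ σ : P, ((blandSwitches σ B : ℝ) + 1) :=
        Finset.sum_le_sum_of_subset_of_nonneg (Finset.subset_univ _) fun σ _ _ => by positivity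
      _ = _ := by rw [Finset.sum_add_distrib]; simp
  have h1' : (n.choose q : ℝ) * Gd.card ≤
      q.factorial * ∑ σ ∈ Gd, ((decreasingSubsets (bMin σ) Finset.univ 0).card : ℝ) := by
    exact_mod_cast h1
  unfold expectedBlandSwitches
  rw [le_div_iff₀ hN, sub_mul, one_mul, sub_le_iff_le_add]
  refine le_trans ?_ h2
  rw [div_div, div_mul_eq_mul_div, div_le_iff₀ (by positivity)]
  calc (n.choose q : ℝ) * Fintype.card P ≤ n.choose q * (2 * Gd.card) :=
        mul_le_mul_of_nonneg_left hgood (Nat.cast_nonneg _)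
    _ = (n.choose q * Gd.card) * 2 := by ring
    _ ≤ _ := mul_le_mul_of_nonneg_right h1' (by norm_num)
    _ = _ := by ring

end Symmetry

end BlandGraph

namespace BlandGraph

open TargetGraph

variable {n r s t : ℕ}

/-- The edges as a sum of products of index sets. -/
def edgeEquiv (n r s t : ℕ) : Edge n r s t ≃
    ((Fin n × Fin r × Fin s) ⊕ (Fin n × Fin r × Fin s × Fin t)) ⊕
    ((Fin n × Fin (r * s)) ⊕ (Fin n × Fin (r * s) × Fin t)) ⊕
    ((Fin n × Fin t) ⊕ (Fin n × Fin t)) ⊕ ((Fin n × Fin r × Fin t) ⊕ (Fin n × Fin t)) where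
  toFun
    | .a1 i j k => .inl (.inl (i, j, k))
    | .a0 i j k l => .inl (.inr (i, j, k, l))
    | .b1 i j => .inr (.inl (.inl (i, j)))
    | .b0 i j l => .inr (.inl (.inr (i, j, l)))
    | .u1 i l => .inr (.inr (.inl (.inl (i, l))))
    | .u0 i l => .inr (.inr (.inl (.inr (i, l))))
    | .w1 i j l => .inr (.inr (.inr (.inl (i, j, l))))
    | .w0 i l => .inr (.inr (.inr (.inr (i, l))))
  invFun
    | .inl (.inl (i, j, k)) => .a1 i j k
    | .inl (.inr (i, j, k, l)) => .a0 i j k l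
    | .inr (.inl (.inl (i, j))) => .b1 i j
    | .inr (.inl (.inr (i, j, l))) => .b0 i j l
    | .inr (.inr (.inl (.inl (i, l)))) => .u1 i l
    | .inr (.inr (.inl (.inr (i, l)))) => .u0 i l
    | .inr (.inr (.inr (.inl (i, j, l)))) => .w1 i j l
    | .inr (.inr (.inr (.inr (i, l)))) => .w0 i l
  left_inv e := by cases e <;> rfl
  right_inv x := by
    rcases x with ((⟨i, j, k⟩ | ⟨i, j, k, l⟩) |
      ((⟨i, j⟩ | ⟨i, j, l⟩) | ((⟨i, l⟩ | ⟨i, l⟩) | (⟨i, j, l⟩ | ⟨i, l⟩)))) <;> rfl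

lemma card_edge (n r s t : ℕ) : Fintype.card (Edge n r s t) =
    n * (2 * (r * s) + 2 * (r * s * t) + 3 * t + r * t) := by
  rw [Fintype.card_congr (edgeEquiv n r s t)]
  simp only [Fintype.card_sum, Fintype.card_prod, Fintype.card_fin]
  ring

/-- The numbers below `m`. -/
def lowIndices (M m : ℕ) : Finset (Fin M) := Finset.univ.filter fun x => (x : ℕ) < m

/-- The numbers that are at least `m`. -/
def highIndices (M m : ℕ) : Finset (Fin M) := Finset.univ.filter fun x => m ≤ (x : ℕ)

lemma card_lowIndices {M m : ℕ} (h : m ≤ M) : (lowIndices M m).card = m := by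
  have : lowIndices M m = Finset.univ.map (Fin.castLEEmb h) := by
    ext x
    simp only [lowIndices, Finset.mem_filter, Finset.mem_univ, true_and, Finset.mem_map]
    exact ⟨fun hx => ⟨⟨x, hx⟩, rfl⟩, by rintro ⟨y, rfl⟩; exact y.2⟩
  rw [this, Finset.card_map, Finset.card_univ, Fintype.card_fin]

lemma card_highIndices {M m : ℕ} (h : m ≤ M) : (highIndices M m).card = M - m := by
  have : highIndices M m = (lowIndices M m)ᶜ := by
    ext x
    simp [lowIndices, highIndices]
  rw [this, Finset.card_compl, card_lowIndices h, Fintype.card_fin]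

open Classical in
/-- The union bound for the probability that a bijection is not good. -/
lemma card_not_good_le {M θ H : ℕ} (hM : Fintype.card (Edge n r s t) = M) (hpos : 0 < M)
    (hH : H ≤ M) (hθ : θ ≤ M) {p₁ p₂ p₃ p₄ : ℝ} (h₀ : 0 ≤ p₁) (h₁ : (H : ℝ) ≤ p₁ * M)
    (h₂ : ((M - H : ℕ) : ℝ) ≤ p₂ * M) (h₃ : (θ : ℝ) ≤ p₃ * M)
    (h₄ : ((M - θ : ℕ) : ℝ) ≤ p₄ * M) :
    ((Finset.univ.filter fun σ : Edge n r s t ≃ Fin (Fintype.card (Edge n r s t)) =>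
        ¬ IsGood σ θ H).card : ℝ) ≤
      Fintype.card (Edge n r s t ≃ Fin (Fintype.card (Edge n r s t))) *
        (M * p₁ ^ t + n * r * p₂ ^ s + n * s ^ r * p₃ ^ r + n * p₄ ^ (r * s)) := by
  subst hM
  set M := Fintype.card (Edge n r s t)
  set N : ℝ := (Fintype.card (Edge n r s t ≃ Fin M) : ℝ) with hN
  have hN₀ : 0 ≤ N := Nat.cast_nonneg _
  let S₁ : Finset (Edge n r s t ≃ Fin M) := (Finset.univ.filter IsMulti).biUnion fun e =>
    mapsInto (Finset.univ.image fun l : Fin t => copy l e) (lowIndices M H)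
  let S₂ : Finset (Edge n r s t ≃ Fin M) :=
    (Finset.univ : Finset (Fin n × Fin r)).biUnion fun x =>
      mapsInto (Finset.univ.image fun k : Fin s => Edge.a1 x.1 x.2 k) (highIndices M H)
  let S₃ : Finset (Edge n r s t ≃ Fin M) :=
    (Finset.univ : Finset (Fin n × (Fin r → Fin s))).biUnion fun x =>
      mapsInto (Finset.univ.image fun j : Fin r => Edge.a1 x.1 j (x.2 j)) (lowIndices M θ)
  let S₄ : Finset (Edge n r s t ≃ Fin M) := (Finset.univ : Finset (Fin n)).biUnion fun i =>
      mapsInto (Finset.univ.image fun j : Fin (r * s) => Edge.b1 i j) (highIndices M θ)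
  have hsub : (Finset.univ.filter fun σ : Edge n r s t ≃ Fin M => ¬ IsGood σ θ H) ⊆
      S₁ ∪ S₂ ∪ S₃ ∪ S₄ := by
    intro σ hσ
    have hσ := (Finset.mem_filter.1 hσ).2
    by_contra hn
    simp only [Finset.mem_union, not_or] at hn
    obtain ⟨⟨⟨n1, n2⟩, n3⟩, n4⟩ := hn
    refine hσ ⟨fun e he => ?_, fun i j => ?_, fun i => ?_, fun i => ?_⟩
    · by_contra! hc
      refine n1 (Finset.mem_biUnion.2 ⟨e, Finset.mem_filter.2 ⟨Finset.mem_univ _, he⟩, ?_⟩)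
      rw [mem_mapsInto]
      intro x hx
      obtain ⟨l, -, rfl⟩ := Finset.mem_image.1 hx
      simpa [lowIndices] using hc l
    · by_contra! hc
      refine n2 (Finset.mem_biUnion.2 ⟨(i, j), Finset.mem_univ _, ?_⟩)
      rw [mem_mapsInto]
      intro x hx
      obtain ⟨k, -, rfl⟩ := Finset.mem_image.1 hx
      simpa [highIndices] using hc k
    · by_contra! hc
      choose f hf using hc
      refine n3 (Finset.mem_biUnion.2 ⟨(i, f), Finset.mem_univ _, ?_⟩)
      rw [mem_mapsInto]
      intro x hx
      obtain ⟨j, -, rfl⟩ := Finset.mem_image.1 hx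
      simpa [lowIndices] using hf j
    · by_contra! hc
      refine n4 (Finset.mem_biUnion.2 ⟨i, Finset.mem_univ _, ?_⟩)
      rw [mem_mapsInto]
      intro x hx
      obtain ⟨j, -, rfl⟩ := Finset.mem_image.1 hx
      simpa [highIndices] using hc j
  have union_le : ∀ {ι : Type} (I : Finset ι) (S : ι → Finset (Edge n r s t ≃ Fin M)) (p : ℝ),
      (∀ i ∈ I, ((S i).card : ℝ) ≤ N * p) → ((I.biUnion S).card : ℝ) ≤ N * (I.card * p) := by
    intro ι I S p h
    calc ((I.biUnion S).card : ℝ) ≤ ∑ i ∈ I, ((S i).card : ℝ) := by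
          exact_mod_cast Finset.card_biUnion_le
      _ ≤ ∑ i ∈ I, N * p := Finset.sum_le_sum h
      _ = _ := by rw [Finset.sum_const, nsmul_eq_mul]; ring
  have c₁ : (S₁.card : ℝ) ≤ N * (M * p₁ ^ t) := by
    refine (union_le _ _ (p₁ ^ t) fun e he => ?_).trans ?_
    · have hcard : (Finset.univ.image fun l : Fin t => copy l e).card = t := by
        rw [Finset.card_image_of_injective, Finset.card_univ, Fintype.card_fin]
        intro l l' h
        have he : IsMulti e := (Finset.mem_filter.1 he).2
        cases e <;> simp_all [copy, IsMulti]
      have := card_mapsInto_le rfl hpos (Finset.univ.image fun l : Fin t => copy l e)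
        (lowIndices M H) (p := p₁) (by rwa [card_lowIndices hH])
      rw [hcard] at this
      exact this
    · refine mul_le_mul_of_nonneg_left (mul_le_mul_of_nonneg_right ?_ (pow_nonneg h₀ _)) hN₀
      exact_mod_cast Finset.card_le_univ _
  have c₂ : (S₂.card : ℝ) ≤ N * (n * r * p₂ ^ s) := by
    have := union_le Finset.univ (fun x : Fin n × Fin r =>
      mapsInto (Finset.univ.image fun k : Fin s => (Edge.a1 x.1 x.2 k : Edge n r s t))
        (highIndices M H)) (p₂ ^ s) fun x _ => ?_
    · simpa using this
    · have hcard : (Finset.univ.image fun k : Fin s =>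
          (Edge.a1 x.1 x.2 k : Edge n r s t)).card = s := by
        rw [Finset.card_image_of_injective, Finset.card_univ, Fintype.card_fin]
        intro l l' h
        simpa using h
      have := card_mapsInto_le rfl hpos (Finset.univ.image fun k : Fin s =>
        (Edge.a1 x.1 x.2 k : Edge n r s t)) (highIndices M H) (p := p₂)
        (by rwa [card_highIndices hH])
      rwa [hcard] at this
  have c₃ : (S₃.card : ℝ) ≤ N * (n * s ^ r * p₃ ^ r) := by
    have := union_le Finset.univ (fun x : Fin n × (Fin r → Fin s) =>
      mapsInto (Finset.univ.image fun j : Fin r => (Edge.a1 x.1 j (x.2 j) : Edge n r s t))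
        (lowIndices M θ)) (p₃ ^ r) fun x _ => ?_
    · simpa using this
    · have hcard : (Finset.univ.image fun j : Fin r =>
          (Edge.a1 x.1 j (x.2 j) : Edge n r s t)).card = r := by
        rw [Finset.card_image_of_injective, Finset.card_univ, Fintype.card_fin]
        intro l l' h
        simp only [Edge.a1.injEq] at h
        exact h.2.1
      have := card_mapsInto_le rfl hpos (Finset.univ.image fun j : Fin r =>
        (Edge.a1 x.1 j (x.2 j) : Edge n r s t)) (lowIndices M θ) (p := p₃)
        (by rwa [card_lowIndices hθ])
      rwa [hcard] at this
  have c₄ : (S₄.card : ℝ) ≤ N * (n * p₄ ^ (r * s)) := by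
    have := union_le Finset.univ (fun i : Fin n =>
      mapsInto (Finset.univ.image fun j : Fin (r * s) => (Edge.b1 i j : Edge n r s t))
        (highIndices M θ)) (p₄ ^ (r * s)) fun x _ => ?_
    · simpa using this
    · have hcard : (Finset.univ.image fun j : Fin (r * s) =>
          (Edge.b1 x j : Edge n r s t)).card = r * s := by
        rw [Finset.card_image_of_injective, Finset.card_univ, Fintype.card_fin]
        intro l l' h
        simpa using h
      have := card_mapsInto_le rfl hpos (Finset.univ.image fun j : Fin (r * s) =>
        (Edge.b1 x j : Edge n r s t)) (highIndices M θ) (p := p₄)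
        (by rwa [card_highIndices hθ])
      rwa [hcard] at this
  have hunion : ((S₁ ∪ S₂ ∪ S₃ ∪ S₄).card : ℝ) ≤ S₁.card + S₂.card + S₃.card + S₄.card := by
    have a1 := Finset.card_union_le (S₁ ∪ S₂ ∪ S₃) S₄
    have a2 := Finset.card_union_le (S₁ ∪ S₂) S₃
    have a3 := Finset.card_union_le S₁ S₂
    exact_mod_cast (by omega : (S₁ ∪ S₂ ∪ S₃ ∪ S₄).card ≤ S₁.card + S₂.card + S₃.card + S₄.card)
  have hle : ((Finset.univ.filter fun σ : Edge n r s t ≃ Fin M => ¬ IsGood σ θ H).card : ℝ) ≤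
      ((S₁ ∪ S₂ ∪ S₃ ∪ S₄).card : ℝ) := by exact_mod_cast Finset.card_le_card hsub
  linarith

end BlandGraph

namespace BlandGraph

open TargetGraph

lemma mul_choose_div_factorial_ge {n q : ℕ} (hn : 16 * q ^ 2 ≤ n) (hq : 2 ≤ q) :
    (4 : ℝ) ^ q ≤ (n.choose q : ℝ) / q.factorial / 2 - 1 := by
  have hqpos : (0 : ℝ) < (q : ℝ) := by exact_mod_cast (by omega : 0 < q)
  have hfac : (0 : ℝ) < q.factorial := by exact_mod_cast q.factorial_pos
  have hle : (q.factorial : ℝ) ≤ (q : ℝ) ^ q := by exact_mod_cast Nat.factorial_le_pow q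
  have h1 : ((n + 1 - q : ℕ) : ℝ) ^ q / q.factorial ≤ n.choose q := Nat.pow_le_choose q n
  have h2 : (8 : ℝ) * q ^ 2 ≤ ((n + 1 - q : ℕ) : ℝ) := by
    have : 8 * q ^ 2 ≤ n + 1 - q := by
      have : q ≤ q ^ 2 := by nlinarith
      omega
    exact_mod_cast this
  have h3 : ((8 : ℝ) * q ^ 2) ^ q ≤ ((n + 1 - q : ℕ) : ℝ) ^ q :=
    pow_le_pow_left₀ (by positivity) h2 _
  have h4 : (8 : ℝ) ^ q ≤ (n.choose q : ℝ) / q.factorial := by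
    rw [le_div_iff₀ hfac]
    refine le_trans ?_ h1
    rw [le_div_iff₀ hfac]
    refine le_trans ?_ h3
    rw [mul_pow, mul_assoc, ← pow_mul, two_mul, pow_add]
    exact mul_le_mul_of_nonneg_left (mul_le_mul hle hle hfac.le (by positivity)) (by positivity)
  have h5 : (8 : ℝ) ^ q = 4 ^ q * 2 ^ q := by rw [← mul_pow]; norm_num
  have h6 : (4 : ℝ) ≤ 2 ^ q := by
    calc (4 : ℝ) = 2 ^ 2 := by norm_num
      _ ≤ 2 ^ q := pow_le_pow_right₀ (by norm_num) hq
  have h7 : (1 : ℝ) ≤ 4 ^ q := one_le_pow₀ (by norm_num)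
  rw [h5] at h4
  nlinarith

open Classical in
/-- For `r = s = t = k`, at least half of all bijections are good. -/
lemma exists_card_le_two_mul_card_good : ∃ K : ℕ, ∀ n k : ℕ, K ≤ k → 1 ≤ n →
    (n : ℝ) ≤ Real.exp (k / 3) →
    ∃ θ H : ℕ, θ ≤ H ∧
      (Fintype.card (Edge n k k k ≃ Fin (Fintype.card (Edge n k k k))) : ℝ) ≤
      2 * (Finset.univ.filter fun σ : Edge n k k k ≃ Fin (Fintype.card (Edge n k k k)) =>
        IsGood σ θ H).card := by
  have hlim : Tendsto (fun k : ℕ => ((k : ℝ) / 15) ^ 3 * Real.exp (-((k : ℝ) / 15))) atTop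
      (nhds 0) :=
    (Real.tendsto_pow_mul_exp_neg_atTop_nhds_zero 3).comp
      (tendsto_natCast_atTop_atTop.atTop_div_const (by norm_num))
  obtain ⟨K, hK⟩ := eventually_atTop.1
    (hlim.eventually (gt_mem_nhds (show (0 : ℝ) < 1 / (22 * 3375) by norm_num)))
  refine ⟨max K 3, fun n k hk hn hexp => ?_⟩
  have hk3 : 3 ≤ k := (le_max_right _ _).trans hk
  have hKk := hK k ((le_max_left _ _).trans hk)
  obtain ⟨M, hM⟩ : ∃ M, Fintype.card (Edge n k k k) = M := ⟨_, rfl⟩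
  have hMval : M = n * (2 * (k * k) + 2 * (k * k * k) + 3 * k + k * k) := by
    rw [← hM, card_edge]
  have hkpos : (0 : ℝ) < k := by exact_mod_cast (by omega : 0 < k)
  have hk3' : (3 : ℝ) ≤ k := by exact_mod_cast hk3
  have hn' : (1 : ℝ) ≤ n := by exact_mod_cast hn
  have hMk : 10 * k ≤ M := by
    rw [hMval]
    calc 10 * k ≤ 2 * (k * k) + 2 * (k * k * k) + 3 * k + k * k := by nlinarith
      _ ≤ _ := Nat.le_mul_of_pos_left _ hn
  have hMk' : (10 : ℝ) * k ≤ M := by exact_mod_cast hMk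
  have hMreal : (M : ℝ) = n * (2 * k ^ 3 + 3 * k ^ 2 + 3 * k) := by
    rw [hMval]; push_cast; ring
  have hpos : 0 < M := by omega
  refine ⟨M / (2 * k), M / 2, Nat.div_le_div_left (by omega) (by norm_num), ?_⟩
  have h₁ : ((M / 2 : ℕ) : ℝ) ≤ 1 / 2 * M := by
    have : ((M / 2 : ℕ) : ℝ) ≤ (M : ℝ) / (2 : ℕ) := Nat.cast_div_le
    push_cast at this
    linarith
  have h₂ : ((M - M / 2 : ℕ) : ℝ) ≤ 3 / 5 * M := by
    have : 5 * (M - M / 2) ≤ 3 * M := by omega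
    have : (5 : ℝ) * ((M - M / 2 : ℕ) : ℝ) ≤ 3 * M := by exact_mod_cast this
    linarith
  have h₃ : ((M / (2 * k) : ℕ) : ℝ) ≤ 1 / (2 * k) * M := by
    have : ((M / (2 * k) : ℕ) : ℝ) ≤ (M : ℝ) / ((2 * k : ℕ) : ℝ) := Nat.cast_div_le
    push_cast at this
    rw [one_div_mul_eq_div]
    exact this
  have h₄ : ((M - M / (2 * k) : ℕ) : ℝ) ≤ (1 - 2 / 5 / k) * M := by
    rw [Nat.cast_sub (Nat.div_le_self _ _)]
    have h : (M : ℝ) / ((2 * k : ℕ) : ℝ) < ((M / (2 * k) : ℕ) : ℝ) + 1 := by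
      rw [div_lt_iff₀ (by positivity)]
      have := Nat.lt_div_mul_add (a := M) (b := 2 * k) (by omega)
      have h' : (M : ℝ) < ((M / (2 * k) : ℕ) : ℝ) * ((2 * k : ℕ) : ℝ) + ((2 * k : ℕ) : ℝ) := by
        exact_mod_cast this
      linarith
    push_cast at h
    have h5 : (1 : ℝ) ≤ M / k / 10 := by
      rw [div_div, le_div_iff₀ (by positivity)]; linarith
    have h6 : (M : ℝ) / (2 * k) = M / k / 2 := by rw [div_div, mul_comm]
    have h7 : (1 - 2 / 5 / (k : ℝ)) * M = M - 2 / 5 * (M / k) := by ring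
    rw [h6] at h
    rw [h7]
    linarith
  have hbad := card_not_good_le hM hpos (Nat.div_le_self _ _) (Nat.div_le_self _ _)
    (by norm_num) h₁ h₂ h₃ h₄
  have hsplit := Finset.card_filter_add_card_filter_not
    (s := (Finset.univ : Finset (Edge n k k k ≃ Fin (Fintype.card (Edge n k k k)))))
    (fun σ => IsGood σ (M / (2 * k)) (M / 2))
  rw [Finset.card_univ] at hsplit
  have hsplit' : ((Finset.univ.filter fun σ : Edge n k k k ≃ Fin (Fintype.card (Edge n k k k)) =>
      IsGood σ (M / (2 * k)) (M / 2)).card : ℝ) +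
      ((Finset.univ.filter fun σ : Edge n k k k ≃ Fin (Fintype.card (Edge n k k k)) =>
      ¬ IsGood σ (M / (2 * k)) (M / 2)).card : ℝ) =
      (Fintype.card (Edge n k k k ≃ Fin (Fintype.card (Edge n k k k))) : ℝ) := by
    exact_mod_cast hsplit
  suffices hs : (M : ℝ) * (1 / 2 : ℝ) ^ k + n * k * (3 / 5) ^ k +
      n * (k : ℝ) ^ k * (1 / (2 * k)) ^ k + n * (1 - 2 / 5 / (k : ℝ)) ^ (k * k) ≤ 1 / 2 by
    have := hbad.trans (mul_le_mul_of_nonneg_left hs (Nat.cast_nonneg _))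
    linarith
  set b : ℝ := Real.exp (-(2 / 5)) with hb
  have hb35 : (3 / 5 : ℝ) ≤ b := by
    have := Real.add_one_le_exp (-(2 / 5 : ℝ))
    linarith
  have e₁ : (1 / 2 : ℝ) ^ k ≤ b ^ k :=
    pow_le_pow_left₀ (by norm_num) (by linarith) _
  have e₂ : (3 / 5 : ℝ) ^ k ≤ b ^ k := pow_le_pow_left₀ (by norm_num) hb35 _
  have e₃ : (k : ℝ) ^ k * (1 / (2 * k)) ^ k ≤ b ^ k := by
    rw [← mul_pow]
    have : (k : ℝ) * (1 / (2 * k)) = 1 / 2 := by field_simp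
    rw [this]
    exact pow_le_pow_left₀ (by norm_num) (by linarith) _
  have hq1 : 2 / 5 / (k : ℝ) ≤ 1 := by
    rw [div_le_one hkpos]; linarith
  have e₄ : (1 - 2 / 5 / (k : ℝ)) ^ (k * k) ≤ b ^ k := by
    rw [pow_mul]
    refine pow_le_pow_left₀ (pow_nonneg (by linarith) _) ?_ _
    calc (1 - 2 / 5 / (k : ℝ)) ^ k ≤ Real.exp (-(2 / 5 / (k : ℝ))) ^ k :=
          pow_le_pow_left₀ (by linarith) (Real.one_sub_le_exp_neg _) _
      _ = b := by
        rw [← Real.exp_nat_mul, hb]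
        congr 1
        field_simp
  have hbk : (n : ℝ) * b ^ k ≤ Real.exp (-((k : ℝ) / 15)) := by
    calc (n : ℝ) * b ^ k ≤ Real.exp (k / 3) * b ^ k :=
          mul_le_mul_of_nonneg_right hexp (by positivity)
      _ = _ := by
        rw [hb, ← Real.exp_nat_mul, ← Real.exp_add]
        congr 1
        ring
  have hn0 : (0 : ℝ) ≤ n := Nat.cast_nonneg _
  calc _ ≤ (M : ℝ) * b ^ k + n * k * b ^ k + n * b ^ k + n * b ^ k := by
        have := mul_le_mul_of_nonneg_left e₁ (Nat.cast_nonneg (α := ℝ) M)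
        have := mul_le_mul_of_nonneg_left e₂ (by positivity : (0 : ℝ) ≤ n * k)
        have := mul_le_mul_of_nonneg_left e₃ hn0
        have := mul_le_mul_of_nonneg_left e₄ hn0
        rw [mul_assoc (n : ℝ) ((k : ℝ) ^ k)]
        linarith
    _ = (2 * (k : ℝ) ^ 3 + 3 * k ^ 2 + 4 * k + 2) * (n * b ^ k) := by rw [hMreal]; ring
    _ ≤ (11 * (k : ℝ) ^ 3) * Real.exp (-((k : ℝ) / 15)) := by
        refine mul_le_mul ?_ hbk (by positivity) (by positivity)
        nlinarith [mul_pos hkpos hkpos]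
    _ = 11 * 3375 * (((k : ℝ) / 15) ^ 3 * Real.exp (-((k : ℝ) / 15))) := by ring
    _ ≤ 1 / 2 := by linarith

section Asymptotic

variable {k : ℕ → ℕ}

lemma tendsto_log_natCast : Tendsto (fun n : ℕ => Real.log n) atTop atTop :=
  Real.tendsto_log_atTop.comp tendsto_natCast_atTop_atTop

lemma tendsto_of_three_mul_log_le (hk : ∀ᶠ n : ℕ in atTop, 3 * Real.log n ≤ (k n : ℝ)) :
    Tendsto k atTop atTop := by
  rw [← tendsto_natCast_atTop_iff (R := ℝ)]
  exact tendsto_atTop_mono' _ hk (tendsto_log_natCast.const_mul_atTop (by norm_num))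

lemma eventually_exp_le_expectedBlandSwitches
    (hk : ∀ᶠ n : ℕ in atTop, 3 * Real.log n ≤ (k n : ℝ)) :
    ∀ᶠ n : ℕ in atTop, ∀ B₀ : (graph n (k n) (k n) (k n)).Tree, IsInitialTree B₀ →
      Real.exp (1 / 8 * √(n : ℝ)) ≤ expectedBlandSwitches B₀ := by
  obtain ⟨K, hK⟩ := exists_card_le_two_mul_card_good
  filter_upwards [hk, (tendsto_of_three_mul_log_le hk).eventually_ge_atTop (max K 1),
    eventually_ge_atTop 64] with n h3 hkK hn B₀ hB₀
  have hn0 : (0 : ℝ) < n := by exact_mod_cast (by omega : 0 < n)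
  have hkpos : 0 < k n := (le_max_right _ _).trans hkK
  have hexp : (n : ℝ) ≤ Real.exp (k n / 3) := by
    rw [← Real.log_le_iff_le_exp hn0]; linarith
  obtain ⟨θ, H, hθ, hgood⟩ := hK n (k n) ((le_max_left _ _).trans hkK) (by omega) hexp
  have hsq : (8 : ℝ) ≤ √(n : ℝ) := by
    rw [Real.le_sqrt' (by norm_num)]
    have : (64 : ℝ) ≤ n := by exact_mod_cast hn
    linarith
  set q := ⌊√(n : ℝ) / 4⌋₊ with hq
  have hq1 : (q : ℝ) ≤ √(n : ℝ) / 4 := Nat.floor_le (by positivity)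
  have hq2 : √(n : ℝ) / 4 < q + 1 := Nat.lt_floor_add_one _
  have hq3 : 2 ≤ q := Nat.le_floor (by push_cast; linarith)
  have hqn : 16 * q ^ 2 ≤ n := by
    have : (16 : ℝ) * (q : ℝ) ^ 2 ≤ n := by
      have h := Real.sq_sqrt hn0.le
      nlinarith [Nat.cast_nonneg (α := ℝ) q]
    exact_mod_cast this
  calc Real.exp (1 / 8 * √(n : ℝ)) ≤ Real.exp (q * 1) := Real.exp_le_exp.2 (by linarith)
    _ = Real.exp 1 ^ q := Real.exp_nat_mul _ _
    _ ≤ 4 ^ q := pow_le_pow_left₀ (Real.exp_pos _).le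
      (by have := Real.exp_one_lt_d9; linarith) _
    _ ≤ _ := mul_choose_div_factorial_ge hqn hq3
    _ ≤ _ := expectedBlandSwitches_ge hkpos hkpos hkpos hθ hB₀ q hgood

lemma isTheta_numEdges (hΘ : (fun n : ℕ => (k n : ℝ)) =Θ[atTop] (fun n : ℕ => Real.log n))
    (hk : ∀ᶠ n : ℕ in atTop, 3 * Real.log n ≤ (k n : ℝ)) :
    (fun n : ℕ => (numEdges n (k n) (k n) (k n) : ℝ)) =Θ[atTop]
      (fun n : ℕ => (n : ℝ) * Real.log n ^ 3) := by
  have hval : ∀ n : ℕ, (numEdges n (k n) (k n) (k n) : ℝ) =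
      n * (2 * (k n : ℝ) ^ 3 + 3 * (k n : ℝ) ^ 2 + 3 * k n) := fun n => by
    rw [numEdges, card_edge]; push_cast; ring
  have h1 : (fun n : ℕ => (numEdges n (k n) (k n) (k n) : ℝ)) =Θ[atTop]
      (fun n : ℕ => (n : ℝ) * (k n : ℝ) ^ 3) := by
    constructor
    · refine IsBigO.of_bound 8 ?_
      filter_upwards [(tendsto_of_three_mul_log_le hk).eventually_ge_atTop 1] with n hn
      have hn' : (1 : ℝ) ≤ k n := by exact_mod_cast hn
      rw [Real.norm_of_nonneg (Nat.cast_nonneg _), Real.norm_of_nonneg (by positivity), hval]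
      have : 2 * (k n : ℝ) ^ 3 + 3 * (k n : ℝ) ^ 2 + 3 * k n ≤ 8 * (k n : ℝ) ^ 3 := by
        have h2 : (k n : ℝ) ≤ (k n : ℝ) ^ 3 := le_self_pow₀ hn' (by norm_num)
        have h3 : (k n : ℝ) ^ 2 ≤ (k n : ℝ) ^ 3 := pow_le_pow_right₀ hn' (by norm_num)
        linarith
      have := mul_le_mul_of_nonneg_left this (Nat.cast_nonneg (α := ℝ) n)
      linarith
    · refine IsBigO.of_bound 1 (Eventually.of_forall fun n => ?_)
      rw [Real.norm_of_nonneg (by positivity), Real.norm_of_nonneg (Nat.cast_nonneg _), hval,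
        one_mul]
      refine mul_le_mul_of_nonneg_left ?_ (Nat.cast_nonneg _)
      have : (0 : ℝ) ≤ (k n : ℝ) ^ 3 := by positivity
      have : (0 : ℝ) ≤ (k n : ℝ) ^ 2 := by positivity
      have : (0 : ℝ) ≤ (k n : ℝ) := by positivity
      linarith
  exact h1.trans ((isTheta_refl _ _).mul (hΘ.pow 3))

lemma isTheta_log_numEdges (hΘ : (fun n : ℕ => (k n : ℝ)) =Θ[atTop] (fun n : ℕ => Real.log n))
    (hk : ∀ᶠ n : ℕ in atTop, 3 * Real.log n ≤ (k n : ℝ)) :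
    (fun n : ℕ => Real.log (numEdges n (k n) (k n) (k n))) =Θ[atTop]
      (fun n : ℕ => Real.log n) := by
  have hlo : ∀ᶠ n : ℕ in atTop, (n : ℝ) ≤ numEdges n (k n) (k n) (k n) := by
    filter_upwards [(tendsto_of_three_mul_log_le hk).eventually_ge_atTop 1] with n hn
    rw [numEdges, card_edge]
    exact_mod_cast Nat.le_mul_of_pos_right n (by omega)
  have hup : ∀ᶠ n : ℕ in atTop, (numEdges n (k n) (k n) (k n) : ℝ) ≤ (n : ℝ) ^ 2 := by
    have h1 : (fun n : ℕ => Real.log n ^ 3) =o[atTop] (fun n : ℕ => (n : ℝ)) :=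
      (Real.isLittleO_pow_log_id_atTop (n := 3)).comp_tendsto tendsto_natCast_atTop_atTop
    have h2 : (fun n : ℕ => (n : ℝ) * Real.log n ^ 3) =o[atTop]
        (fun n : ℕ => (n : ℝ) * (n : ℝ)) := (isBigO_refl _ _).mul_isLittleO h1
    have h3 := (isTheta_numEdges hΘ hk).isBigO.trans_isLittleO h2
    filter_upwards [h3.bound one_pos] with n hn
    rw [Real.norm_of_nonneg (Nat.cast_nonneg _), Real.norm_of_nonneg (by positivity)] at hn
    linarith
  constructor
  · refine IsBigO.of_bound 2 ?_
    filter_upwards [hlo, hup, eventually_ge_atTop 1] with n h1 h2 hn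
    have hn' : (1 : ℝ) ≤ n := by exact_mod_cast hn
    rw [Real.norm_of_nonneg (Real.log_nonneg (hn'.trans h1)),
      Real.norm_of_nonneg (Real.log_nonneg hn')]
    have := Real.log_le_log (by linarith) h2
    rw [Real.log_pow] at this
    exact_mod_cast this
  · refine IsBigO.of_bound 1 ?_
    filter_upwards [hlo, eventually_ge_atTop 1] with n h1 hn
    have hn' : (1 : ℝ) ≤ n := by exact_mod_cast hn
    rw [Real.norm_of_nonneg (Real.log_nonneg (hn'.trans h1)),
      Real.norm_of_nonneg (Real.log_nonneg hn'), one_mul]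
    exact Real.log_le_log (by linarith) h1

lemma isTheta_sqrt (hΘ : (fun n : ℕ => (k n : ℝ)) =Θ[atTop] (fun n : ℕ => Real.log n))
    (hk : ∀ᶠ n : ℕ in atTop, 3 * Real.log n ≤ (k n : ℝ)) :
    (fun n : ℕ => √(n : ℝ)) =Θ[atTop]
      (fun n : ℕ => √(numEdges n (k n) (k n) (k n) : ℝ) /
        Real.log (numEdges n (k n) (k n) (k n)) ^ (3 / 2 : ℝ)) := by
  have hlogn : ∀ n : ℕ, 0 ≤ Real.log n := fun n => Real.log_natCast_nonneg n
  have h1 : (fun n : ℕ => √(numEdges n (k n) (k n) (k n) : ℝ)) =Θ[atTop]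
      (fun n : ℕ => √((n : ℝ) * Real.log n ^ 3)) := by
    exact (isTheta_numEdges hΘ hk).sqrt
      (Eventually.of_forall fun n => Nat.cast_nonneg _)
      (Eventually.of_forall fun n => mul_nonneg (Nat.cast_nonneg _) (pow_nonneg (hlogn n) _))
  have h2 := IsTheta.rpow (r := 3 / 2)
    (Eventually.of_forall fun n => Real.log_natCast_nonneg _) (Eventually.of_forall hlogn)
    (isTheta_log_numEdges hΘ hk)
  refine ((h1.div h2).trans_eventuallyEq ?_).symm
  filter_upwards [tendsto_log_natCast.eventually_gt_atTop 0] with n hn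
  have h3 : √(Real.log n ^ 3) = Real.log n ^ (3 / 2 : ℝ) := by
    rw [Real.sqrt_eq_rpow, ← Real.rpow_natCast, ← Real.rpow_mul hn.le]
    norm_num
  rw [Real.sqrt_mul (Nat.cast_nonneg _), h3, mul_div_assoc, div_self, mul_one]
  exact (Real.rpow_pos_of_pos hn _).ne'

end Asymptotic

end BlandGraph

theorem mainTheorem3 :
    ∃ c : ℝ, 0 < c ∧
      ∀ k : ℕ → ℕ,
        (fun n : ℕ => (k n : ℝ)) =Θ[atTop] (fun n : ℕ => Real.log n) →
        (∀ᶠ n : ℕ in atTop, 3 * Real.log n ≤ (k n : ℝ)) →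
        (∀ᶠ n : ℕ in atTop,
          ∀ B₀ : (BlandGraph.graph n (k n) (k n) (k n)).Tree, BlandGraph.IsInitialTree B₀ →
            Real.exp (c * √(n : ℝ)) ≤ TargetGraph.expectedBlandSwitches B₀) ∧
        (fun n : ℕ => √(n : ℝ)) =Θ[atTop]
          (fun n : ℕ => √(BlandGraph.numEdges n (k n) (k n) (k n) : ℝ) /
            Real.log (BlandGraph.numEdges n (k n) (k n) (k n)) ^ (3 / 2 : ℝ)) ∧
        ∃ d : ℝ, 0 < d ∧ ∀ᶠ n : ℕ in atTop,
          ∀ B₀ : (BlandGraph.graph n (k n) (k n) (k n)).Tree, BlandGraph.IsInitialTree B₀ →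
            Real.exp (d * (√(BlandGraph.numEdges n (k n) (k n) (k n) : ℝ) /
                Real.log (BlandGraph.numEdges n (k n) (k n) (k n)) ^ (3 / 2 : ℝ))) ≤
              TargetGraph.expectedBlandSwitches B₀ := by
  refine ⟨1 / 8, by norm_num, fun k hΘ hk => ?_⟩
  have hmain := BlandGraph.eventually_exp_le_expectedBlandSwitches hk
  have hsqrt := BlandGraph.isTheta_sqrt hΘ hk
  refine ⟨hmain, hsqrt, ?_⟩
  obtain ⟨C, hC, hbound⟩ := hsqrt.symm.isBigO.exists_pos
  refine ⟨1 / 8 / C, by positivity, ?_⟩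
  filter_upwards [hmain, hbound.bound] with n h1 h2 B₀ hB₀
  refine le_trans (Real.exp_le_exp.2 ?_) (h1 B₀ hB₀)
  rw [Real.norm_of_nonneg (Real.sqrt_nonneg _)] at h2
  rw [div_mul_eq_mul_div, div_le_iff₀ hC]
  have := (le_abs_self _).trans h2
  linarith
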